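/- Let $G\subset\mathbb{C}$ be a nonempty connected open set, and let $f$ be a meromorphic function on an open set $G'\subset\mathbb{C}$ with $\mathrm{cl}(G)\subset G'$; put $|f(z)|=\infty$ at the poles $z$ of $f$. For $\epsilon\in[0,\infty]$ let $E_{f,\epsilon}=\{z\in G':|f(z)|=\epsilon\}$ be the level set of $f$ at height $\epsilon$. A connected component of some $E_{f,\epsilon}$ is called a level curve of $f$. A critical level curve of $f$ is a level curve that contains a critical point of $f$ (a point which is not a pole of $f$ and at which $f'=0$) and that does not consist just of a zero or a pole of $f$. Assume the following. 1. $|f|\equiv1$ on each unbounded component of $\partial G$, and for each bounded component $K$ of $\partial G$ there is some $\rho\in(0,\infty)$ with $|f|\equiv\rho$ on $K$. 2. If $G$ is unbounded, then $\lim_{z\in G,\,z\to\infty}|f(z)|=1$. 3. $G$ does not contain any unbounded level curve of $f$. 4. The complement $\mathbb{C}\setminus G$ has only finitely many bounded components. 5. No level curve of $f$ in $G$ meets $\partial G$; that is, for each $z\in G$, the closure of the level curve of $f$ through $z$ is contained in $G$. Then for each $\epsilon\in[0,\infty]$, only finitely many components of $E_{f,\epsilon}$ are contained in $G$. Moreover,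 only finitely many critical level curves of $f$ are contained in $G$. -/

import Mathlib

open Set Filter Topology Bornology
open scoped ENNReal

namespace LevelCurves

/-- The connected components of a subset `S` of the plane. -/
def componentsOf (S : Set ℂ) : Set (Set ℂ) :=
  {K | ∃ z ∈ S, K = connectedComponentIn S z}

/-- The modulus `|f(z)| ∈ [0, ∞]` of a meromorphic function with values in the Riemann sphere.
The function `f` is represented by its normal form (`MeromorphicNFOn`): it is analytic at every
point which is not a pole, and its (meaningless) complex value at a pole is replaced here by `∞`. -/
noncomputable def modulus (f : ℂ → ℂ) (z : ℂ) : ℝ≥0∞ :=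
  open Classical in if meromorphicOrderAt f z < 0 then ⊤ else ‖f z‖ₑ

/-- The level set `E_{f,ε} = {z ∈ D : |f(z)| = ε}` of a function `f` with domain `D`. -/
def levelSet (f : ℂ → ℂ) (D : Set ℂ) (ε : ℝ≥0∞) : Set ℂ :=
  {z ∈ D | modulus f z = ε}

/-- A level curve of `f` (with domain `D`) is a component of some level set of `f`. -/
def IsLevelCurve (f : ℂ → ℂ) (D : Set ℂ) (L : Set ℂ) : Prop :=
  ∃ ε : ℝ≥0∞, L ∈ componentsOf (levelSet f D ε)

/-- The level curve of `f` through the point `z`. -/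
noncomputable def levelCurveThrough (f : ℂ → ℂ) (D : Set ℂ) (z : ℂ) : Set ℂ :=
  connectedComponentIn (levelSet f D (modulus f z)) z

/-- A zero of `f'`, at a point which is not a pole of `f`. -/
def IsCriticalPt (f : ℂ → ℂ) (z : ℂ) : Prop :=
  AnalyticAt ℂ f z ∧ deriv f z = 0

/-- A critical level curve of `f` is a level curve which does not just consist of a zero or a pole
of `f`, and which contains a critical point of `f`. -/
def IsCriticalLevelCurve (f : ℂ → ℂ) (D : Set ℂ) (L : Set ℂ) : Prop :=
  IsLevelCurve f D L ∧
  (¬ ∃ z, L = {z} ∧ (modulus f z = 0 ∨ modulus f z = ⊤)) ∧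
  ∃ z ∈ L, IsCriticalPt f z

end LevelCurves

namespace LevelCurves

/-! Delete from `G` its finitely many zeros and poles to get `Ω`, and mark these points together
with one point in each bounded component of the complement of `G`. A bounded open set with boundary
in `Ω` and no mark inside lies in `Ω`, so both the maximum and the minimum principle hold on it.
Hence a nonempty bounded open set with boundary in `Ω` on which `|f|` is constant contains a mark
(`MarkedDomain.exists_mark`).

Send a level curve `L` in `G`, at a level in `(0, ∞)`, to the set of marks in its hull.
`finite_of_marks` shows this map injective on the families in question: curves with the same
nonempty set of marks have intersecting hulls, so one lies in a bounded face of the other, and it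
suffices that the outer hull has an extra mark. At equal levels the region between the curves
supplies it. If the outer curve is critical, it has two bounded faces, and one not containing the
inner curve supplies it.

The faces are found through `MarkedCurve.exists_sign`: near `L`, within one face, `|f|` stays on one
side of its level. This rests on unicoherence, which makes the boundary of a face connected. Since
`|f|` takes larger and smaller values near `L`, there are at least two faces, one of them bounded.
At a critical point four rays alternate in sign; planarity (`false_of_alternating_rays`) then forces
three faces, two of them bounded.

The levels `0` and `∞` are covered by the finiteness of zeros and poles. -/

/-! ### Continuous logarithms and unicoherence of the plane -/

/-- A continuous logarithm of the constant function `1` on a preconnected set is constant. -/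
lemma eq_of_exp_eq_one {S : Set ℂ} (hS : IsPreconnected S) {ψ : ℂ → ℂ} (hψ : ContinuousOn ψ S)
    (h : ∀ z ∈ S, Complex.exp (ψ z) = 1) {x y : ℂ} (hx : x ∈ S) (hy : y ∈ S) : ψ x = ψ y := by
  refine hS.induction₂ (fun x y => ψ x = ψ y) (fun x hx => ?_)
    (fun x y z _ _ _ h₁ h₂ => h₁.trans h₂) (fun x y _ _ h => h.symm) hx hy
  -- Values lie in `2πiℤ`, so two of them at distance below `1` coincide.
  have hc := (hψ x hx).eventually (Metric.ball_mem_nhds (ψ x) one_pos)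
  filter_upwards [hc, self_mem_nhdsWithin] with y hy hyS
  obtain ⟨m, hm⟩ := Complex.exp_eq_one_iff.1 (h x hx)
  obtain ⟨n, hn⟩ := Complex.exp_eq_one_iff.1 (h y hyS)
  rw [dist_eq_norm, hm, hn, ← sub_mul, ← Int.cast_sub] at hy
  simp only [Complex.norm_mul, Complex.norm_intCast, Complex.norm_ofNat, Complex.norm_real,
    Complex.norm_I, mul_one, Real.norm_eq_abs, abs_of_pos Real.pi_pos] at hy
  have h3 := Real.pi_gt_three
  have : |((n - m : ℤ) : ℝ)| < 1 := by nlinarith [abs_nonneg ((n - m : ℤ) : ℝ)]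
  rw [← Int.cast_abs] at this
  have h0 : n - m = 0 := Int.abs_lt_one_iff.1 (by exact_mod_cast this)
  rw [hm, hn, sub_eq_zero.1 h0]

/-- The plane is unicoherent. -/
theorem isPreconnected_inter_of_union_eq_univ {X Y : Set ℂ} (hX : IsClosed X) (hY : IsClosed Y)
    (hXc : IsPreconnected X) (hYc : IsPreconnected Y) (hXY : X ∪ Y = univ) :
    IsPreconnected (X ∩ Y) := by
  classical
  rw [isPreconnected_closed_iff]
  rintro A B hA hB hAB ⟨a, ha, haA⟩ ⟨b, hb, hbB⟩
  by_contra hne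
  have hdisj : Disjoint (A ∩ (X ∩ Y)) (B ∩ (X ∩ Y)) := by
    rw [Set.disjoint_left]
    rintro z ⟨hzA, hz⟩ ⟨hzB, -⟩
    exact hne ⟨z, hz, hzA, hzB⟩
  obtain ⟨φ, hφA, hφB, -⟩ := exists_continuous_zero_one_of_isClosed
    (hA.inter (hX.inter hY)) (hB.inter (hX.inter hY)) hdisj
  -- Gluing `exp E` on `X` with `1` on `Y` gives a continuous nonvanishing function on the plane,
  -- hence a logarithm `ψ`. It is constant on `Y`, and `ψ - E` is constant on `X`, so `E a = E b`;
  -- but these are `0` and `2πi`.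
  let E : ℂ → ℂ := fun z => 2 * Real.pi * Complex.I * (φ z : ℂ)
  have hE : Continuous E := by fun_prop
  have hg : ∃ g : ℂ → ℂ, Continuous g ∧ (∀ z ∈ X, g z = Complex.exp (E z)) ∧
      ∀ z ∈ Y, g z = 1 := by
    have hEY : ∀ z ∈ X, z ∈ Y → Complex.exp (E z) = 1 := by
      intro z hzX hzY
      rcases hAB ⟨hzX, hzY⟩ with h | h
      · have : φ z = 0 := hφA ⟨h, hzX, hzY⟩
        simp [E, this]
      · have : φ z = 1 := hφB ⟨h, hzX, hzY⟩
        simp [E, this]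
    have h1 : ∀ z ∈ X, (if z ∈ X then Complex.exp (E z) else 1) = Complex.exp (E z) :=
      fun z hz => if_pos hz
    have h2 : ∀ z ∈ Y, (if z ∈ X then Complex.exp (E z) else 1) = 1 := by
      intro z hz
      split_ifs with h
      · exact hEY z h hz
      · rfl
    refine ⟨fun z => if z ∈ X then Complex.exp (E z) else 1, ?_, h1, h2⟩
    rw [← continuousOn_univ, ← hXY]
    exact ContinuousOn.union_of_isClosed
      ((Complex.continuous_exp.comp hE).continuousOn.congr h1)
      (continuousOn_const.congr h2) hX hY
  obtain ⟨g, hgc, hgX, hgY⟩ := hg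
  have hsc : IsSimplyConnected (univ : Set ℂ) := by
    have := (Homeomorph.Set.univ ℂ).contractibleSpace
    exact SimplyConnectedSpace.ofContractible (univ : Set ℂ)
  obtain ⟨ψ, hψc, hψ⟩ := Complex.exists_continuousOn_eqOn_exp_comp hsc isOpen_univ
    hgc.continuousOn (by
      rintro ⟨z, -, hz⟩
      rcases (hXY ▸ mem_univ z : z ∈ X ∪ Y) with h | h
      · rw [hgX z h] at hz; exact Complex.exp_ne_zero _ hz
      · rw [hgY z h] at hz; exact one_ne_zero hz)
  have hψ' : ∀ z, Complex.exp (ψ z) = g z := fun z => hψ (mem_univ z)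
  have e1 : ψ a = ψ b := eq_of_exp_eq_one hYc (hψc.mono (subset_univ _))
    (fun z hz => by rw [hψ', hgY z hz]) ha.2 hb.2
  have e2 : ψ a - E a = ψ b - E b := eq_of_exp_eq_one (ψ := fun z => ψ z - E z) hXc
    ((hψc.mono (subset_univ _)).sub hE.continuousOn)
    (fun z hz => by rw [Complex.exp_sub, hψ', hgX z hz, div_self (Complex.exp_ne_zero _)])
    ha.1 hb.1
  have ea : φ a = 0 := hφA ⟨haA, ha⟩
  have eb : φ b = 1 := hφB ⟨hbB, hb⟩
  rw [e1] at e2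
  have e3 : E a = E b := by linear_combination -e2
  simp [E, ea, eb] at e3

/-! ### Complementary components -/

/-- The boundary of a complementary component of a closed set lies in this set. -/
lemma frontier_component_subset {S : Set ℂ} (hS : IsClosed S) (z : ℂ) :
    frontier (connectedComponentIn Sᶜ z) ⊆ S := by
  intro w hw
  by_contra hwS
  have hopen : IsOpen (connectedComponentIn Sᶜ w) := hS.isOpen_compl.connectedComponentIn
  have hwm : w ∈ connectedComponentIn Sᶜ w := mem_connectedComponentIn hwS
  have hwc : w ∈ closure (connectedComponentIn Sᶜ z) := hw.1
  obtain ⟨x, hx1, hx2⟩ := mem_closure_iff.1 hwc _ hopen hwm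
  have h : w ∈ connectedComponentIn Sᶜ z := by
    rw [connectedComponentIn_eq hx2, ← connectedComponentIn_eq hx1]; exact hwm
  have ho : IsOpen (connectedComponentIn Sᶜ z) := hS.isOpen_compl.connectedComponentIn
  exact hw.2 (ho.interior_eq.symm ▸ h)

/-- A complementary component of a closed connected set, together with this set, is connected. -/
lemma isPreconnected_component_union {S : Set ℂ} (hS : IsClosed S) (hSc : IsConnected S) (z : ℂ) :
    IsPreconnected (connectedComponentIn Sᶜ z ∪ S) := by
  by_cases hz : z ∈ Sᶜ
  · set F := connectedComponentIn Sᶜ z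
    have hF : F.Nonempty := ⟨z, mem_connectedComponentIn hz⟩
    have hFu : F ≠ univ := by
      intro h
      obtain ⟨s, hs⟩ := hSc.nonempty
      exact connectedComponentIn_subset Sᶜ z (h ▸ mem_univ s : s ∈ F) hs
    obtain ⟨w, hw⟩ := nonempty_frontier_iff.2 ⟨hF, hFu⟩
    have hwS := frontier_component_subset hS z hw
    have := IsPreconnected.union w (frontier_subset_closure hw) hwS
      isPreconnected_connectedComponentIn.closure hSc.isPreconnected
    convert this using 1
    refine subset_antisymm (union_subset_union_left _ subset_closure) (union_subset ?_
      subset_union_right)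
    rw [closure_eq_self_union_frontier]
    exact union_subset_union_right _ (frontier_component_subset hS z)
  · rw [connectedComponentIn_eq_empty hz, empty_union]
    exact hSc.isPreconnected

/-- The complement of a complementary component of a closed connected set is connected. -/
lemma isPreconnected_compl_component {S : Set ℂ} (hS : IsClosed S) (hSc : IsConnected S) (z : ℂ) :
    IsPreconnected (connectedComponentIn Sᶜ z)ᶜ := by
  obtain ⟨s, hs⟩ := hSc.nonempty
  have hsub : S ⊆ (connectedComponentIn Sᶜ z)ᶜ :=
    fun x hx h => connectedComponentIn_subset _ _ h hx
  -- Each other component hangs on to `S`, so it joins its points to `s` off the given component.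
  refine isPreconnected_of_forall s fun y hy => ?_
  refine ⟨connectedComponentIn Sᶜ y ∪ S, union_subset (fun x hx h => hy ?_) hsub, .inr hs, ?_,
    isPreconnected_component_union hS hSc y⟩
  · by_cases hyS : y ∈ Sᶜ
    · rw [connectedComponentIn_eq h, ← connectedComponentIn_eq hx]
      exact mem_connectedComponentIn hyS
    · rw [connectedComponentIn_eq_empty hyS] at hx
      exact hx.elim
  · by_cases hyS : y ∈ S
    · exact .inr hyS
    · exact .inl (mem_connectedComponentIn hyS)

/-- The boundary of a complementary component of a closed connected subset of the plane is
connected. -/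
theorem isPreconnected_frontier_component {S : Set ℂ} (hS : IsClosed S) (hSc : IsConnected S)
    (z : ℂ) : IsPreconnected (frontier (connectedComponentIn Sᶜ z)) := by
  have ho : IsOpen (connectedComponentIn Sᶜ z) := hS.isOpen_compl.connectedComponentIn
  -- The frontier is the intersection of two closed connected sets covering the plane.
  have := isPreconnected_inter_of_union_eq_univ (X := closure (connectedComponentIn Sᶜ z))
    (Y := (connectedComponentIn Sᶜ z)ᶜ) isClosed_closure ho.isClosed_compl
    isPreconnected_connectedComponentIn.closure (isPreconnected_compl_component hS hSc z)
    (by rw [eq_univ_iff_forall]; intro x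
        by_cases hx : x ∈ connectedComponentIn Sᶜ z
        · exact .inl (subset_closure hx)
        · exact .inr hx)
  rwa [ho.frontier_eq, sdiff_eq]

/-- The exterior of a disc is the image of a convex half-plane under `exp`. -/
lemma isConnected_compl_closedBall {R : ℝ} (hR : 0 < R) :
    IsConnected (Metric.closedBall (0 : ℂ) R)ᶜ := by
  have h : (Metric.closedBall (0 : ℂ) R)ᶜ = Complex.exp '' {z | Real.log R < z.re} := by
    ext w
    simp only [mem_compl_iff, mem_closedBall_zero_iff, not_le, mem_image]
    constructor
    · intro hw
      have hw0 : w ≠ 0 := by rintro rfl; simp at hw; linarith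
      refine ⟨Complex.log w, ?_, Complex.exp_log hw0⟩
      show Real.log R < (Complex.log w).re
      rw [Complex.log_re]
      exact Real.log_lt_log hR hw
    · rintro ⟨z, hz, rfl⟩
      rw [Complex.norm_exp]
      exact (Real.log_lt_iff_lt_exp hR).1 hz
  rw [h]
  refine IsConnected.image ⟨⟨((Real.log R + 1 : ℝ) : ℂ), ?_⟩,
    (convex_halfSpace_re_gt _).isPreconnected⟩ _ Complex.continuous_exp.continuousOn
  show Real.log R < ((Real.log R + 1 : ℝ) : ℂ).re
  simp

lemma not_isBounded_compl_closedBall (R : ℝ) : ¬ IsBounded (Metric.closedBall (0 : ℂ) R)ᶜ := by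
  intro h
  have := h.union (Metric.isBounded_closedBall (x := (0 : ℂ)) (r := R))
  rw [compl_union_self] at this
  exact NormedSpace.unbounded_univ ℂ ℂ this

/-- An unbounded complementary component of a bounded set contains a neighbourhood of infinity. -/
lemma compl_closedBall_subset_component {S : Set ℂ} {R : ℝ} (hR : 0 < R)
    (hS : S ⊆ Metric.closedBall 0 R) {z w : ℂ} (hw : w ∈ connectedComponentIn Sᶜ z)
    (hwR : w ∉ Metric.closedBall 0 R) :
    (Metric.closedBall 0 R)ᶜ ⊆ connectedComponentIn Sᶜ z := by
  rw [connectedComponentIn_eq hw]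
  exact (isConnected_compl_closedBall hR).isPreconnected.subset_connectedComponentIn hwR
    (compl_subset_compl.2 hS)

/-- A finite subset of a connected open set lies in a compact connected subset. -/
lemma exists_isCompact_isConnected_subset {D : Set ℂ} (hD : IsOpen D) (hDc : IsConnected D)
    {F : Set ℂ} (hF : F.Finite) (hFD : F ⊆ D) :
    ∃ K, IsCompact K ∧ IsConnected K ∧ F ⊆ K ∧ K ⊆ D := by
  obtain ⟨d, hd⟩ := hDc.nonempty
  have hp := hD.isConnected_iff_isPathConnected.1 hDc
  suffices ∃ K, IsCompact K ∧ IsConnected K ∧ F ⊆ K ∧ K ⊆ D ∧ d ∈ K by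
    obtain ⟨K, h1, h2, h3, h4, -⟩ := this
    exact ⟨K, h1, h2, h3, h4⟩
  induction F, hF using Set.Finite.induction_on with
  | empty => exact ⟨{d}, isCompact_singleton, isConnected_singleton, empty_subset _, by simpa, rfl⟩
  | @insert a s _ _ ih =>
    obtain ⟨K, hK1, hK2, hK3, hK4, hK5⟩ := ih ((subset_insert _ _).trans hFD)
    obtain ⟨γ, hγ⟩ := hp.joinedIn d hd a (hFD (mem_insert _ _))
    refine ⟨K ∪ range γ, hK1.union (isCompact_range γ.continuous),
      hK2.union ⟨d, hK5, ⟨0, by simp⟩⟩ (isConnected_range γ.continuous), ?_,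
      union_subset hK4 (range_subset_iff.2 hγ), .inl hK5⟩
    exact insert_subset (.inr ⟨1, by simp⟩) (hK3.trans subset_union_left)

/-- A connected component of a compact set has neighbourhoods whose boundary avoids this set. -/
lemma exists_isOpen_frontier_disjoint {K : Set ℂ} (hK : IsCompact K) {x : ℂ} (hx : x ∈ K)
    {N : Set ℂ} (hN : IsOpen N) (hL : connectedComponentIn K x ⊆ N) :
    ∃ U, IsOpen U ∧ connectedComponentIn K x ⊆ U ∧ U ⊆ N ∧ Disjoint (frontier U) K := by
  have : CompactSpace K := isCompact_iff_compactSpace.1 hK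
  -- In a compact Hausdorff space a component is an intersection of clopen sets, so by compactness
  -- one clopen `C` already lies in `N`. Then `U` separates the compact sets `C` and `K \ C`.
  have h1 : (⋂ s : { s : Set K // IsClopen s ∧ (⟨x, hx⟩ : K) ∈ s }, (s : Set K)) ⊆
      ((↑) : K → ℂ) ⁻¹' N := by
    rw [← connectedComponent_eq_iInter_isClopen]
    intro y hy
    apply hL
    rw [connectedComponentIn_eq_image hx]
    exact mem_image_of_mem _ hy
  have hdir : Directed (fun a b : Set K => b ⊆ a)
      (fun s : { s : Set K // IsClopen s ∧ (⟨x, hx⟩ : K) ∈ s } => (s : Set K)) :=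
    fun s t => ⟨⟨s ∩ t, s.2.1.inter t.2.1, s.2.2, t.2.2⟩, inter_subset_left, inter_subset_right⟩
  have : Nonempty { s : Set K // IsClopen s ∧ (⟨x, hx⟩ : K) ∈ s } :=
    ⟨⟨univ, isClopen_univ, mem_univ _⟩⟩
  obtain ⟨⟨C, hC, hxC⟩, hCN⟩ := exists_subset_nhds_of_compactSpace hdir
    (fun s => s.2.1.1) (fun y hy => (hN.preimage continuous_subtype_val).mem_nhds (h1 hy))
  simp only at hCN
  have hC1 : IsCompact (((↑) : K → ℂ) '' C) := hC.1.isCompact.image continuous_subtype_val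
  have hC2 : IsCompact (((↑) : K → ℂ) '' Cᶜ) :=
    hC.compl.1.isCompact.image continuous_subtype_val
  have hdis : ((↑) : K → ℂ) '' C ⊆ N ∩ (((↑) : K → ℂ) '' Cᶜ)ᶜ := by
    rintro _ ⟨y, hy, rfl⟩
    refine ⟨hCN hy, ?_⟩
    rintro ⟨y', hy', h⟩
    exact hy' (Subtype.ext h ▸ hy)
  obtain ⟨U, hU, hCU, hUN⟩ := exists_open_between_and_isCompact_closure hC1
    (hN.inter hC2.isClosed.isOpen_compl) hdis
  refine ⟨U, hU, ?_, subset_closure.trans (hUN.1.trans inter_subset_left), ?_⟩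
  · rw [connectedComponentIn_eq_image hx]
    exact (image_mono (isPreconnected_connectedComponent.subset_isClopen hC
      ⟨_, mem_connectedComponent, hxC⟩)).trans hCU
  · rw [Set.disjoint_left]
    intro y hyU hyK
    by_cases hy : (⟨y, hyK⟩ : K) ∈ C
    · rw [hU.frontier_eq] at hyU
      exact hyU.2 (hCU ⟨_, hy, rfl⟩)
    · exact (hUN.1 hyU.1).2 ⟨⟨y, hyK⟩, hy, rfl⟩

/-! ### Crossing of rays -/

/-- Moving a point inside a connected set which avoids a closed set `J` does not change the
variation of the argument along `J`. -/
lemma exists_log_div {J D : Set ℂ} (hJ : IsClosed J) (hD : IsPreconnected D) (hJD : Disjoint J D)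
    {a b : ℂ} (ha : a ∈ D) (hb : b ∈ D) :
    ∃ ψ : ℂ → ℂ, ContinuousOn ψ J ∧ ∀ z ∈ J, Complex.exp (ψ z) = (z - a) / (z - b) := by
  have hne : ∀ x ∈ D, ∀ z ∈ J, z - x ≠ 0 := fun x hx z hz h =>
    Set.disjoint_left.1 hJD hz (sub_eq_zero.1 h ▸ hx)
  refine hD.induction₂ (fun a b => ∃ ψ : ℂ → ℂ, ContinuousOn ψ J ∧
    ∀ z ∈ J, Complex.exp (ψ z) = (z - a) / (z - b)) (fun x hx => ?_) ?_ ?_ ha hb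
  · obtain ⟨r, hr, hrJ⟩ := Metric.isOpen_iff.1 hJ.isOpen_compl x (Set.disjoint_right.1 hJD hx)
    filter_upwards [mem_nhdsWithin_of_mem_nhds (Metric.ball_mem_nhds x hr), self_mem_nhdsWithin]
      with y hy hyD
    -- A move shorter than the distance `r` to `J` keeps the quotient within `1` of `1`, where the
    -- principal logarithm is continuous.
    have hslit : ∀ z ∈ J, (z - y) / (z - x) ∈ Complex.slitPlane := by
      intro z hz
      have h1 : (z - y) / (z - x) = 1 + (x - y) / (z - x) := by
        field_simp [hne x hx z hz]; ring
      rw [h1]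
      apply Complex.mem_slitPlane_of_norm_lt_one
      have h2 : r ≤ ‖z - x‖ := by
        by_contra! h
        exact hrJ (by rwa [Metric.mem_ball, dist_eq_norm]) hz
      rw [norm_div, div_lt_one (hr.trans_le h2)]
      rw [Metric.mem_ball, dist_comm, dist_eq_norm] at hy
      exact hy.trans_le h2
    refine ⟨fun z => -Complex.log ((z - y) / (z - x)), ?_, fun z hz => ?_⟩
    · exact (ContinuousOn.clog (ContinuousOn.div (by fun_prop) (by fun_prop) (hne x hx))
        hslit).neg
    · rw [Complex.exp_neg, Complex.exp_log (Complex.slitPlane_ne_zero (hslit z hz)), inv_div]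
  · rintro x y z hx hy hz ⟨ψ₁, h1, h1'⟩ ⟨ψ₂, h2, h2'⟩
    refine ⟨fun w => ψ₁ w + ψ₂ w, h1.add h2, fun w hw => ?_⟩
    rw [Complex.exp_add, h1' w hw, h2' w hw, div_mul_div_cancel₀ (hne y hy w hw)]
  · rintro x y hx hy ⟨ψ, h1, h1'⟩
    exact ⟨fun w => -ψ w, h1.neg, fun w hw => by rw [Complex.exp_neg, h1' w hw, inv_div]⟩

/-- A ray from `1` meets the cut only if it points in the negative real direction. -/
lemma one_add_mul_exp_mem_slitPlane {η : ℝ} (h1 : -Real.pi < η) (h2 : η < Real.pi) {x : ℝ}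
    (hx : 0 ≤ x) : 1 + (x : ℂ) * Complex.exp (η * Complex.I) ∈ Complex.slitPlane := by
  rw [Complex.mem_slitPlane_iff]
  simp only [Complex.add_re, Complex.one_re, Complex.re_ofReal_mul, Complex.exp_ofReal_mul_I_re,
    Complex.add_im, Complex.one_im, zero_add, Complex.im_ofReal_mul, Complex.exp_ofReal_mul_I_im]
  by_cases h : x * Real.sin η = 0
  · left
    rcases mul_eq_zero.1 h with h | h
    · simp [h]
    · rw [Real.sin_eq_zero_iff_of_lt_of_lt h1 h2] at h
      rw [h, Real.cos_zero]; linarith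
  · exact .inr h

/-- Scaling by `t / s > 0` keeps the argument and moves the point to `t / s + exp (iη)`. -/
lemma tendsto_log_im_one_add {η : ℝ} (h1 : -Real.pi < η) (h2 : η < Real.pi) {s : ℝ} (hs : 0 < s) :
    Tendsto (fun t : ℝ => (Complex.log (1 + ((s / t : ℝ) : ℂ) * Complex.exp (η * Complex.I))).im)
      (𝓝[>] 0) (𝓝 η) := by
  have harg : Complex.arg (Complex.exp (η * Complex.I)) = η := by
    rw [Complex.arg_exp_mul_I, toIocMod_eq_self Real.two_pi_pos]
    constructor <;> linarith
  have hsl : Complex.exp (η * Complex.I) ∈ Complex.slitPlane := by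
    rw [Complex.mem_slitPlane_iff_arg, harg]
    exact ⟨h2.ne, Complex.exp_ne_zero _⟩
  have hc : Tendsto (fun t : ℝ => Complex.arg (((t / s : ℝ) : ℂ) + Complex.exp (η * Complex.I)))
      (𝓝[>] 0) (𝓝 η) := by
    have h3 : Tendsto (fun t : ℝ => ((t / s : ℝ) : ℂ) + Complex.exp (η * Complex.I))
        (𝓝[>] 0) (𝓝 (Complex.exp (η * Complex.I))) := by
      have : ContinuousAt (fun t : ℝ => ((t / s : ℝ) : ℂ) + Complex.exp (η * Complex.I)) 0 := by
        fun_prop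
      have h4 := this.tendsto
      simp only [zero_div, Complex.ofReal_zero, zero_add] at h4
      exact h4.mono_left nhdsWithin_le_nhds
    have := (Complex.continuousAt_arg hsl).tendsto.comp h3
    rwa [harg] at this
  refine hc.congr' ?_
  filter_upwards [self_mem_nhdsWithin] with t ht
  have ht : 0 < t := ht
  rw [Complex.log_im, ← Complex.arg_real_mul _ (div_pos hs ht)]
  congr 1
  push_cast
  have h5 : (s : ℂ) ≠ 0 := by exact_mod_cast hs.ne'
  have h6 : (t : ℂ) ≠ 0 := by exact_mod_cast ht.ne'
  field_simp

/-- Two disjoint connected sets cannot contain rays at a common point which alternate. -/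
theorem false_of_alternating_rays {D₁ D₂ : Set ℂ} (hD₁ : IsOpen D₁) (hc₁ : IsConnected D₁)
    (hc₂ : IsPreconnected D₂) (hD : Disjoint D₁ D₂) {z₀ : ℂ} (hz₁ : z₀ ∉ D₁) (hz₂ : z₀ ∉ D₂)
    {ω : ℂ} (hω : ‖ω‖ = 1) {α : ℝ} (hα : 0 < α) (hα' : α ≤ Real.pi / 2) {δ : ℝ} (hδ : 0 < δ)
    (h0 : ∀ t : ℝ, 0 < t → t ≤ δ → z₀ + t * (ω * Complex.exp ((0 : ℝ) * Complex.I)) ∈ D₁)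
    (h1 : ∀ t : ℝ, 0 < t → t ≤ δ → z₀ + t * (ω * Complex.exp ((α : ℝ) * Complex.I)) ∈ D₂)
    (h2 : ∀ t : ℝ, 0 < t → t ≤ δ → z₀ + t * (ω * Complex.exp ((2 * α : ℝ) * Complex.I)) ∈ D₁)
    (h3 : ∀ t : ℝ, 0 < t → t ≤ δ → z₀ + t * (ω * Complex.exp ((3 * α : ℝ) * Complex.I)) ∈ D₂) :
    False := by
  have hpi := Real.pi_pos
  have hω0 : ω ≠ 0 := by rintro rfl; simp at hω
  set ray : ℝ → ℝ → ℂ := fun β t => z₀ + t * (ω * Complex.exp ((β : ℝ) * Complex.I)) with hray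
  have hrayc : ∀ β, Continuous (ray β) := fun β => by fun_prop
  have hray0 : ∀ β, ray β 0 = z₀ := fun β => by simp [hray]
  have hraynorm : ∀ β t, ‖ray β t - z₀‖ = |t| := by
    intro β t
    simp [hray, hω]
  obtain ⟨γ, hγ⟩ := (hD₁.isConnected_iff_isPathConnected.1 hc₁).joinedIn (ray 0 δ)
    (h0 δ hδ le_rfl) (ray (2 * α) δ) (h2 δ hδ le_rfl)
  set K := range γ with hK
  have hKD : K ⊆ D₁ := range_subset_iff.2 hγ
  have hKc : IsCompact K := isCompact_range γ.continuous
  obtain ⟨r, hr, hrK⟩ := Metric.isOpen_iff.1 hKc.isClosed.isOpen_compl z₀ (fun h => hz₁ (hKD h))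
  -- `s ≤ δ` puts `b₁`, `b₃` in `D₂`; `s < r` makes both closer to `z₀` than any point of `K`. The
  -- closed curve `J` runs through `D₁` and `z₀`; `J'` is `J` without `z₀`.
  obtain ⟨s, hs, hsr, hsδ⟩ : ∃ s : ℝ, 0 < s ∧ s < r ∧ s ≤ δ :=
    ⟨min (r / 2) δ, by positivity, (min_le_left _ _).trans_lt (by linarith), min_le_right _ _⟩
  set b₁ := ray α s with hb₁
  set b₃ := ray (3 * α) s with hb₃
  set J := K ∪ ray 0 '' Icc 0 δ ∪ ray (2 * α) '' Icc 0 δ with hJ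
  set J' := K ∪ ray 0 '' Ioc 0 δ ∪ ray (2 * α) '' Ioc 0 δ with hJ'
  have hJ'J : J' ⊆ J := union_subset_union (union_subset_union_right _
    (image_mono Ioc_subset_Icc_self)) (image_mono Ioc_subset_Icc_self)
  have hJc : IsClosed J := ((hKc.union (isCompact_Icc.image (hrayc _))).union
    (isCompact_Icc.image (hrayc _))).isClosed
  have hray_im : ∀ β, (∀ t : ℝ, 0 < t → t ≤ δ → ray β t ∈ D₁) →
      ray β '' Icc 0 δ ⊆ D₁ ∪ {z₀} := by
    rintro β h _ ⟨t, ht, rfl⟩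
    rcases ht.1.eq_or_lt with h' | h'
    · right; rw [← h', hray0]; rfl
    · exact .inl (h t h' ht.2)
  have hJD : J ⊆ D₁ ∪ {z₀} := union_subset (union_subset (hKD.trans subset_union_left)
    (hray_im _ h0)) (hray_im _ h2)
  have hJdis : Disjoint J D₂ := by
    refine Disjoint.mono_left hJD ?_
    rw [disjoint_union_left]
    exact ⟨hD, by simpa using hz₂⟩
  obtain ⟨ψ, hψc, hψ⟩ : ∃ ψ : ℂ → ℂ, ContinuousOn ψ J ∧
      ∀ z ∈ J, Complex.exp (ψ z) = (z - b₁) / (z - b₃) := exists_log_div hJc hc₂ hJdis (h1 s hs hsδ) (h3 s hs hsδ)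
  -- the quotients on the rays
  have hquot : ∀ β β' η : ℝ, Complex.exp ((β' - β : ℝ) * Complex.I) =
      -Complex.exp (η * Complex.I) → ∀ t : ℝ, 0 < t → (ray β t - ray β' s) / (ray β t - z₀) =
        1 + ((s / t : ℝ) : ℂ) * Complex.exp (η * Complex.I) := by
    intro β β' η h t ht
    have h5 : (t : ℂ) ≠ 0 := by exact_mod_cast ht.ne'
    have h6 := Complex.exp_ne_zero (β * Complex.I)
    have h7 : Complex.exp (β' * Complex.I) =
        Complex.exp (β * Complex.I) * -Complex.exp (η * Complex.I) := by
      rw [← h, ← Complex.exp_add]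
      congr 1
      push_cast; ring
    simp only [hray, h7]
    push_cast
    field_simp
    ring
  have hexp_sub : ∀ x : ℝ, Complex.exp (x * Complex.I) =
      -Complex.exp ((x - Real.pi : ℝ) * Complex.I) := by
    intro x
    rw [show ((x - Real.pi : ℝ) : ℂ) * Complex.I = x * Complex.I - Real.pi * Complex.I by
      push_cast; ring, Complex.exp_sub, Complex.exp_pi_mul_I]
    rw [div_neg, div_one, neg_neg]
  have hexp_add : ∀ x : ℝ, Complex.exp (x * Complex.I) =
      -Complex.exp ((x + Real.pi : ℝ) * Complex.I) := by
    intro x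
    rw [show ((x + Real.pi : ℝ) : ℂ) * Complex.I = x * Complex.I + Real.pi * Complex.I by
      push_cast; ring, Complex.exp_add, Complex.exp_pi_mul_I]
    simp
  -- Each angle difference is shifted by `±π` into `(-π, π)`. Only `q21` needs `+π`; this is the
  -- source of the contradiction.
  have q01 := hquot 0 α (α - Real.pi) (by rw [sub_zero]; exact hexp_sub _)
  have q03 := hquot 0 (3 * α) (3 * α - Real.pi) (by rw [sub_zero]; exact hexp_sub _)
  have q21 := hquot (2 * α) α (-α + Real.pi)
    (by rw [show α - 2 * α = -α by ring]; exact hexp_add _)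
  have q23 := hquot (2 * α) (3 * α) (α - Real.pi)
    (by rw [show 3 * α - 2 * α = α by ring]; exact hexp_sub _)
  have hslitK : ∀ β, ∀ z ∈ K, (z - ray β s) / (z - z₀) ∈ Complex.slitPlane := by
    intro β z hz
    have hzr : r ≤ ‖z - z₀‖ := by
      by_contra! h
      exact hrK (by rwa [Metric.mem_ball, dist_eq_norm]) hz
    have hz0 : z - z₀ ≠ 0 := norm_pos_iff.1 (hr.trans_le hzr)
    rw [show (z - ray β s) / (z - z₀) = 1 + (z₀ - ray β s) / (z - z₀) by field_simp; ring]
    apply Complex.mem_slitPlane_of_norm_lt_one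
    rw [norm_div, div_lt_one (hr.trans_le hzr), norm_sub_rev, hraynorm, abs_of_pos hs]
    exact hsr.trans_le hzr
  have hslit : ∀ z ∈ J', (z - b₁) / (z - z₀) ∈ Complex.slitPlane ∧
      (z - b₃) / (z - z₀) ∈ Complex.slitPlane := by
    rintro z ((hz | ⟨t, ht, rfl⟩) | ⟨t, ht, rfl⟩)
    · exact ⟨hslitK _ z hz, hslitK _ z hz⟩
    · rw [hb₁, hb₃, q01 t ht.1, q03 t ht.1]
      exact ⟨one_add_mul_exp_mem_slitPlane (by linarith) (by linarith) (div_pos hs ht.1).le,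
        one_add_mul_exp_mem_slitPlane (by linarith) (by linarith) (div_pos hs ht.1).le⟩
    · rw [hb₁, hb₃, q21 t ht.1, q23 t ht.1]
      exact ⟨one_add_mul_exp_mem_slitPlane (by linarith) (by linarith) (div_pos hs ht.1).le,
        one_add_mul_exp_mem_slitPlane (by linarith) (by linarith) (div_pos hs ht.1).le⟩
  have hJ'z : ∀ z ∈ J', z - z₀ ≠ 0 := by
    intro z hz h
    have := (hslit z hz).1
    rw [h, div_zero] at this
    exact Complex.slitPlane_ne_zero this rfl
  have hJ'c : IsPreconnected J' := by
    have hK1 : IsPreconnected K := isPreconnected_range γ.continuous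
    have hI : ∀ β, IsPreconnected (ray β '' Ioc 0 δ) := fun β =>
      isPreconnected_Ioc.image _ (hrayc β).continuousOn
    refine IsPreconnected.union (ray (2 * α) δ) (.inl ⟨1, by simp⟩)
      ⟨δ, ⟨hδ, le_rfl⟩, rfl⟩ (IsPreconnected.union (ray 0 δ) ⟨0, by simp⟩
      ⟨δ, ⟨hδ, le_rfl⟩, rfl⟩ hK1 (hI _)) (hI _)
  -- An explicit logarithm of the same quotient as `ψ`, available on `J'` only; it differs from `ψ`
  -- by a constant there.
  set Λ : ℂ → ℂ := fun z => Complex.log ((z - b₁) / (z - z₀)) - Complex.log ((z - b₃) / (z - z₀))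
    with hΛ
  have hΛc : ContinuousOn Λ J' :=
    (ContinuousOn.clog (ContinuousOn.div (by fun_prop) (by fun_prop) hJ'z)
      fun z hz => (hslit z hz).1).sub
    (ContinuousOn.clog (ContinuousOn.div (by fun_prop) (by fun_prop) hJ'z)
      fun z hz => (hslit z hz).2)
  have hconst : ∀ x ∈ J', ∀ y ∈ J', ψ x - Λ x = ψ y - Λ y := by
    intro x hx y hy
    refine eq_of_exp_eq_one (ψ := fun z => ψ z - Λ z) hJ'c ((hψc.mono hJ'J).sub hΛc)
      (fun z hz => ?_) hx hy
    have e1 := Complex.slitPlane_ne_zero (hslit z hz).1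
    have e2 := Complex.slitPlane_ne_zero (hslit z hz).2
    rw [Complex.exp_sub, hψ z (hJ'J hz), hΛ, Complex.exp_sub, Complex.exp_log e1,
      Complex.exp_log e2, div_div_div_cancel_right₀ (hJ'z z hz)]
    apply div_self
    intro h
    rcases div_eq_zero_iff.1 h with h | h
    · rw [h, zero_div] at e1; exact e1 rfl
    · rw [h, zero_div] at e2; exact e2 rfl
  set c := (ψ (ray 0 δ) - Λ (ray 0 δ)).im with hc
  have hδJ : ray 0 δ ∈ J' := .inl (.inr ⟨δ, ⟨hδ, le_rfl⟩, rfl⟩)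
  have hz₀J : z₀ ∈ J := .inl (.inr ⟨0, ⟨le_rfl, hδ.le⟩, hray0 _⟩)
  have hlim : ∀ β, ray β '' Ioc 0 δ ⊆ J' → ∀ η₁ η₃ : ℝ,
      Tendsto (fun t => (Λ (ray β t)).im) (𝓝[>] 0) (𝓝 (η₁ - η₃)) →
      (ψ z₀).im - (η₁ - η₃) = c := by
    intro β hβ η₁ η₃ hΛlim
    have hev : ∀ᶠ t : ℝ in 𝓝[>] 0, t ∈ Ioc 0 δ := Ioc_mem_nhdsGT hδ
    have ht1 : Tendsto (ray β) (𝓝[>] 0) (𝓝[J] z₀) := by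
      refine tendsto_nhdsWithin_iff.2 ⟨?_, ?_⟩
      · have := (hrayc β).tendsto 0
        rw [hray0] at this
        exact this.mono_left nhdsWithin_le_nhds
      · filter_upwards [hev] with t ht using hJ'J (hβ ⟨t, ht, rfl⟩)
    have ht2 : Tendsto (fun t => (ψ (ray β t)).im) (𝓝[>] 0) (𝓝 (ψ z₀).im) :=
      (Complex.continuous_im.tendsto _).comp ((hψc z₀ hz₀J).tendsto.comp ht1)
    refine tendsto_nhds_unique (ht2.sub hΛlim) (tendsto_const_nhds.congr' ?_)
    filter_upwards [hev] with t ht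
    rw [hc, ← hconst _ (hβ ⟨t, ht, rfl⟩) _ hδJ, Complex.sub_im]
  have l0 := hlim 0 (subset_union_right.trans subset_union_left) (α - Real.pi) (3 * α - Real.pi) (by
    refine ((tendsto_log_im_one_add (η := α - Real.pi) (by linarith) (by linarith) hs).sub
      (tendsto_log_im_one_add (η := 3 * α - Real.pi) (by linarith) (by linarith) hs)).congr' ?_
    filter_upwards [self_mem_nhdsWithin] with t ht
    simp only [hΛ, hb₁, hb₃]
    rw [q01 t ht, q03 t ht, Complex.sub_im])
  have l2 := hlim (2 * α) subset_union_right (-α + Real.pi) (α - Real.pi) (by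
    refine ((tendsto_log_im_one_add (η := -α + Real.pi) (by linarith) (by linarith) hs).sub
      (tendsto_log_im_one_add (η := α - Real.pi) (by linarith) (by linarith) hs)).congr' ?_
    filter_upwards [self_mem_nhdsWithin] with t ht
    simp only [hΛ, hb₁, hb₃]
    rw [q21 t ht, q23 t ht, Complex.sub_im])
  -- At `z₀` the imaginary part of `Λ` tends to `-2α` along one ray and to `2π - 2α` along the
  -- other, whereas `ψ` is continuous there.
  linarith

/-! ### Maximum and minimum principles relative to finitely many marked points -/

/-- `f` is analytic, without zeros and nowhere locally constant on the open set `Ω`, and every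
bounded open set with boundary in `Ω` which is not contained in `Ω` contains one of the finitely
many points of `P`. -/
structure MarkedDomain (f : ℂ → ℂ) (Ω P : Set ℂ) : Prop where
  isOpen : IsOpen Ω
  finite : P.Finite
  analytic : ∀ z ∈ Ω, AnalyticAt ℂ f z
  ne_zero : ∀ z ∈ Ω, f z ≠ 0
  nonconst : ∀ z ∈ Ω, ¬ ∀ᶠ w in 𝓝 z, f w = f z
  fill : ∀ O : Set ℂ, IsOpen O → IsBounded O → frontier O ⊆ Ω → Disjoint O P → O ⊆ Ω

namespace MarkedDomain

variable {f : ℂ → ℂ} {Ω P : Set ℂ}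

/-- Passing to `1 / f` turns maximum principles into minimum principles. -/
lemma inv (h : MarkedDomain f Ω P) : MarkedDomain f⁻¹ Ω P where
  isOpen := h.isOpen
  finite := h.finite
  analytic z hz := (h.analytic z hz).inv (h.ne_zero z hz)
  ne_zero z hz := inv_ne_zero (h.ne_zero z hz)
  nonconst z hz hc := h.nonconst z hz (hc.mono fun _ hw => inv_injective hw)
  fill := h.fill

lemma exists_norm_gt (h : MarkedDomain f Ω P) {z : ℂ} (hz : z ∈ Ω) {U : Set ℂ} (hU : U ∈ 𝓝 z) :
    ∃ w ∈ U, ‖f z‖ < ‖f w‖ := by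
  by_contra! hcon
  refine h.nonconst z hz (Complex.eventually_eq_of_isLocalMax_norm
    ((h.analytic z hz).eventually_analyticAt.mono fun w hw => hw.differentiableAt) ?_)
  filter_upwards [hU] with w hw using hcon w hw

lemma exists_norm_lt (h : MarkedDomain f Ω P) {z : ℂ} (hz : z ∈ Ω) {U : Set ℂ} (hU : U ∈ 𝓝 z) :
    ∃ w ∈ U, ‖f w‖ < ‖f z‖ := by
  obtain ⟨w, ⟨hwU, hwΩ⟩, hw⟩ := h.inv.exists_norm_gt hz
    (inter_mem hU (h.isOpen.mem_nhds hz))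
  refine ⟨w, hwU, ?_⟩
  simp only [Pi.inv_apply, norm_inv] at hw
  exact (inv_lt_inv₀ (norm_pos_iff.2 (h.ne_zero z hz)) (norm_pos_iff.2 (h.ne_zero w hwΩ))).1 hw

/-- `fill` puts the closure of `O` in `Ω`, where the maximum principle gives `≤`; strictness follows
since `|f|` has no local maximum. -/
lemma norm_lt_of_frontier (h : MarkedDomain f Ω P) {O : Set ℂ} (hO : IsOpen O)
    (hOb : IsBounded O) (hOΩ : frontier O ⊆ Ω) (hOP : Disjoint O P) {ρ : ℝ}
    (hρ : ∀ z ∈ frontier O, ‖f z‖ ≤ ρ) : ∀ z ∈ O, ‖f z‖ < ρ := by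
  have hsub := h.fill O hO hOb hOΩ hOP
  have hcl : closure O ⊆ Ω := by
    rw [closure_eq_self_union_frontier]
    exact union_subset hsub hOΩ
  have hd : DiffContOnCl ℂ f O := DifferentiableOn.diffContOnCl fun z hz =>
    (h.analytic z (hcl hz)).differentiableAt.differentiableWithinAt
  intro z hz
  obtain ⟨w, hw, hzw⟩ := h.exists_norm_gt (hsub hz) (hO.mem_nhds hz)
  exact hzw.trans_le
    (Complex.norm_le_of_forall_mem_frontier_norm_le hOb hd hρ (subset_closure hw))

lemma lt_norm_of_frontier (h : MarkedDomain f Ω P) {O : Set ℂ} (hO : IsOpen O)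
    (hOb : IsBounded O) (hOΩ : frontier O ⊆ Ω) (hOP : Disjoint O P) {ρ : ℝ} (hρ0 : 0 < ρ)
    (hρ : ∀ z ∈ frontier O, ρ ≤ ‖f z‖) : ∀ z ∈ O, ρ < ‖f z‖ := by
  intro z hz
  have := h.inv.norm_lt_of_frontier hO hOb hOΩ hOP (ρ := ρ⁻¹) (fun w hw => by
    simp only [Pi.inv_apply, norm_inv]
    exact inv_anti₀ hρ0 (hρ w hw)) z hz
  simp only [Pi.inv_apply, norm_inv] at this
  exact (inv_lt_inv₀ (norm_pos_iff.2 (h.ne_zero z (h.fill O hO hOb hOΩ hOP hz))) hρ0).1 this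

/-- A bounded open set on whose boundary `|f|` is constant contains a marked point. -/
lemma exists_mark (h : MarkedDomain f Ω P) {O : Set ℂ} (hO : IsOpen O) (hne : O.Nonempty)
    (hOb : IsBounded O) (hOΩ : frontier O ⊆ Ω) {ρ : ℝ} (hρ0 : 0 < ρ)
    (hρ : ∀ z ∈ frontier O, ‖f z‖ = ρ) : ∃ p ∈ P, p ∈ O := by
  by_contra! hcon
  have hOP : Disjoint O P := Set.disjoint_right.2 hcon
  obtain ⟨z, hz⟩ := hne
  exact lt_asymm (h.norm_lt_of_frontier hO hOb hOΩ hOP (fun z hz => (hρ z hz).le) z hz)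
    (h.lt_norm_of_frontier hO hOb hOΩ hOP hρ0 (fun z hz => (hρ z hz).ge) z hz)

end MarkedDomain

/-! ### Rays at a critical point -/

/-- On the ray the second factor is `1 + t ^ n * (ω ^ n * h)`, with real part above `1` for small `t
> 0`. -/
lemma eventually_norm_lt_norm_ray {F h : ℂ → ℂ} {z₀ : ℂ} {n : ℕ} (hh : ContinuousAt h z₀)
    (hF : ∀ᶠ z in 𝓝 z₀, F z = F z₀ * (1 + (z - z₀) ^ n * h z)) (hF0 : F z₀ ≠ 0) {ω : ℂ}
    (hω : 0 < (ω ^ n * h z₀).re) : ∀ᶠ t : ℝ in 𝓝[>] 0, ‖F z₀‖ < ‖F (z₀ + t * ω)‖ := by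
  have hray : Tendsto (fun t : ℝ => z₀ + t * ω) (𝓝[>] 0) (𝓝 z₀) := by
    have : Continuous fun t : ℝ => z₀ + t * ω := by fun_prop
    have h1 := this.tendsto 0
    simp only [Complex.ofReal_zero, zero_mul, add_zero] at h1
    exact h1.mono_left nhdsWithin_le_nhds
  have hre : ∀ᶠ z in 𝓝 z₀, 0 < (ω ^ n * h z).re :=
    (Complex.continuous_re.continuousAt.comp (continuousAt_const.mul hh)).eventually_const_lt hω
  filter_upwards [hray.eventually hF, hray.eventually hre, self_mem_nhdsWithin] with t h1 h2 h3
  have h3 : 0 < t := h3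
  rw [h1, norm_mul]
  refine lt_mul_of_one_lt_right (norm_pos_iff.2 hF0) (lt_of_lt_of_le ?_ (Complex.re_le_norm _))
  rw [add_sub_cancel_left, mul_pow, mul_assoc, ← Complex.ofReal_pow, Complex.add_re,
    Complex.re_ofReal_mul, Complex.one_re]
  have := mul_pos (pow_pos h3 n) h2
  linarith

/-- At a critical point which is not a zero, there are four equally spaced rays along which `|f|`
is alternatingly greater and smaller than at this point. -/
theorem exists_alternating_rays {f : ℂ → ℂ} {z₀ : ℂ} (hf : AnalyticAt ℂ f z₀) (h0 : f z₀ ≠ 0)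
    (hnc : ¬ ∀ᶠ w in 𝓝 z₀, f w = f z₀) (hd : deriv f z₀ = 0) :
    ∃ (ω : ℂ) (α : ℝ), ‖ω‖ = 1 ∧ 0 < α ∧ α ≤ Real.pi / 2 ∧
      (∀ᶠ t : ℝ in 𝓝[>] 0, ‖f z₀‖ < ‖f (z₀ + t * (ω * Complex.exp ((0 : ℝ) * Complex.I)))‖) ∧
      (∀ᶠ t : ℝ in 𝓝[>] 0, ‖f (z₀ + t * (ω * Complex.exp ((α : ℝ) * Complex.I)))‖ < ‖f z₀‖) ∧
      (∀ᶠ t : ℝ in 𝓝[>] 0,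
        ‖f z₀‖ < ‖f (z₀ + t * (ω * Complex.exp ((2 * α : ℝ) * Complex.I)))‖) ∧
      (∀ᶠ t : ℝ in 𝓝[>] 0,
        ‖f (z₀ + t * (ω * Complex.exp ((3 * α : ℝ) * Complex.I)))‖ < ‖f z₀‖) := by
  have hfs : AnalyticAt ℂ (fun z => f z - f z₀) z₀ := hf.sub analyticAt_const
  obtain ⟨n, g, hg, hg0, hfg⟩ := hfs.exists_eventuallyEq_pow_smul_nonzero_iff.2
    (fun h => hnc (h.mono fun w hw => sub_eq_zero.1 hw))
  have hn : 2 ≤ n := by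
    by_contra! hn
    interval_cases n
    · have := hfg.self_of_nhds
      simp at this
      exact hg0 this.symm
    · have h1 : HasDerivAt (fun z => f z - f z₀) 0 z₀ := by
        have := hf.differentiableAt.hasDerivAt.sub_const (f z₀)
        rwa [hd] at this
      have h2 : HasDerivAt (fun z => (z - z₀) ^ 1 • g z) (g z₀) z₀ := by
        have := ((hasDerivAt_id z₀).sub_const z₀).mul hg.differentiableAt.hasDerivAt
        simp only [id, sub_self, zero_mul, add_zero, one_mul] at this
        exact this.congr_of_eventuallyEq (.of_forall fun z => by simp)
      exact hg0 ((h2.congr_of_eventuallyEq hfg).unique h1)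
  set h : ℂ → ℂ := fun z => g z / f z₀ with hh
  have hhc : ContinuousAt h z₀ := hg.continuousAt.div_const _
  have hF : ∀ᶠ z in 𝓝 z₀, f z = f z₀ * (1 + (z - z₀) ^ n * h z) := by
    filter_upwards [hfg] with z hz
    rw [smul_eq_mul] at hz
    rw [hh]
    field_simp
    linear_combination hz
  -- The corresponding factor for `1 / f`; it takes the value `-h z₀` at `z₀`.
  set h' : ℂ → ℂ := fun z => -h z * (f z₀ / f z) with hh'
  have hhc' : ContinuousAt h' z₀ := hhc.neg.mul (continuousAt_const.div hf.continuousAt h0)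
  have hF' : ∀ᶠ z in 𝓝 z₀, f⁻¹ z = f⁻¹ z₀ * (1 + (z - z₀) ^ n * h' z) := by
    filter_upwards [hF, hf.continuousAt.eventually_ne h0] with z hz hz0
    simp only [Pi.inv_apply, hh']
    field_simp
    linear_combination -hz
  have hc0 : h z₀ ≠ 0 := div_ne_zero hg0 h0
  have hn0 : (n : ℝ) ≠ 0 := by positivity
  have hn0' : (n : ℂ) ≠ 0 := by exact_mod_cast hn0
  -- `ω` makes `ω ^ n * h z₀` positive, and each rotation by `π / n` flips the sign.
  set ω := Complex.exp ((-(Complex.arg (h z₀) / n) : ℝ) * Complex.I) with hω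
  set α := Real.pi / n with hα
  have hpow : ∀ β : ℝ, (ω * Complex.exp (β * Complex.I)) ^ n * h z₀ =
      ‖h z₀‖ * Complex.exp ((n * β : ℝ) * Complex.I) := by
    intro β
    conv_lhs => rw [← Complex.norm_mul_exp_arg_mul_I (h z₀)]
    rw [hω, ← Complex.exp_add, ← Complex.exp_nat_mul, mul_left_comm, ← Complex.exp_add]
    congr 2
    push_cast
    field_simp
    ring
  have hplus : ∀ β : ℝ, Real.cos (n * β) = 1 →
      ∀ᶠ t : ℝ in 𝓝[>] 0, ‖f z₀‖ < ‖f (z₀ + t * (ω * Complex.exp (β * Complex.I)))‖ := by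
    intro β hβ
    refine eventually_norm_lt_norm_ray hhc hF h0 ?_
    rw [hpow, Complex.re_ofReal_mul, Complex.exp_ofReal_mul_I_re, hβ, mul_one]
    exact norm_pos_iff.2 hc0
  have hminus : ∀ β : ℝ, Real.cos (n * β) = -1 →
      ∀ᶠ t : ℝ in 𝓝[>] 0, ‖f (z₀ + t * (ω * Complex.exp (β * Complex.I)))‖ < ‖f z₀‖ := by
    intro β hβ
    have hray : Tendsto (fun t : ℝ => z₀ + t * (ω * Complex.exp (β * Complex.I))) (𝓝[>] 0)
        (𝓝 z₀) := by
      have : Continuous fun t : ℝ => z₀ + t * (ω * Complex.exp (β * Complex.I)) := by fun_prop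
      have h1 := this.tendsto 0
      simp only [Complex.ofReal_zero, zero_mul, add_zero] at h1
      exact h1.mono_left nhdsWithin_le_nhds
    have h1 := eventually_norm_lt_norm_ray hhc' hF' (inv_ne_zero h0)
      (ω := ω * Complex.exp (β * Complex.I)) (by
        have : h' z₀ = -h z₀ := by rw [hh']; field_simp
        rw [this, mul_neg, hpow, Complex.neg_re, Complex.re_ofReal_mul,
          Complex.exp_ofReal_mul_I_re, hβ, mul_neg_one, neg_neg]
        exact norm_pos_iff.2 hc0)
    filter_upwards [h1, hray.eventually (hf.continuousAt.eventually_ne h0)] with t ht1 ht2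
    simp only [Pi.inv_apply, norm_inv] at ht1
    exact (inv_lt_inv₀ (norm_pos_iff.2 h0) (norm_pos_iff.2 ht2)).1 ht1
  have hnα : n * α = Real.pi := by rw [hα]; field_simp
  refine ⟨ω, α, Complex.norm_exp_ofReal_mul_I _, by positivity, ?_, hplus 0 (by simp),
    hminus α (by rw [hnα, Real.cos_pi]), hplus (2 * α) ?_, hminus (3 * α) ?_⟩
  · rw [hα]
    exact div_le_div_of_nonneg_left Real.pi_pos.le two_pos (by exact_mod_cast hn)
  · rw [show n * (2 * α) = 2 * (n * α) by ring, hnα, Real.cos_two_pi]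
  · rw [show n * (3 * α) = n * α + 2 * (n * α) by ring, hnα, Real.cos_add_two_pi, Real.cos_pi]

/-! ### Faces of level curves -/

/-- A compact connected subset of `{|f| = ρ}` with small neighbourhoods whose boundaries avoid
this level set. -/
structure MarkedCurve (f : ℂ → ℂ) (Ω : Set ℂ) (ρ : ℝ) (L : Set ℂ) : Prop where
  isCompact : IsCompact L
  isConnected : IsConnected L
  subset : L ⊆ Ω
  norm_eq : ∀ z ∈ L, ‖f z‖ = ρ
  isolating : ∀ N, IsOpen N → L ⊆ N →
    ∃ U, IsOpen U ∧ L ⊆ U ∧ closure U ⊆ N ∧ ∀ z ∈ frontier U, ‖f z‖ ≠ ρ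

/-- Both components contain the exterior of a large disc. -/
lemma component_eq_of_not_isBounded {S : Set ℂ} (hS : IsBounded S) {a b : ℂ}
    (ha : ¬ IsBounded (connectedComponentIn Sᶜ a)) (hb : ¬ IsBounded (connectedComponentIn Sᶜ b)) :
    connectedComponentIn Sᶜ a = connectedComponentIn Sᶜ b := by
  obtain ⟨R, hR, hSR⟩ := hS.subset_closedBall_lt 0 0
  have key : ∀ a, ¬ IsBounded (connectedComponentIn Sᶜ a) →
      (Metric.closedBall 0 R)ᶜ ⊆ connectedComponentIn Sᶜ a := by
    intro a ha
    obtain ⟨w, hw, hwR⟩ := Set.not_subset.1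
      (fun h : connectedComponentIn Sᶜ a ⊆ Metric.closedBall 0 R =>
        ha (Metric.isBounded_closedBall.subset h))
    exact compl_closedBall_subset_component hR hSR hw hwR
  obtain ⟨w, hw⟩ := (isConnected_compl_closedBall hR).nonempty
  rw [connectedComponentIn_eq (key a ha hw), connectedComponentIn_eq (key b hb hw)]

/-- A real function which is continuous on a preconnected set and omits a value there stays on one side of it. -/
lemma forall_lt_or_forall_gt {S : Set ℂ} (hS : IsPreconnected S) {u : ℂ → ℝ}
    (hu : ContinuousOn u S) {ρ : ℝ} (h : ∀ z ∈ S, u z ≠ ρ) :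
    (∀ z ∈ S, ρ < u z) ∨ (∀ z ∈ S, u z < ρ) := by
  by_contra! hcon
  obtain ⟨⟨a, ha, ha'⟩, ⟨b, hb, hb'⟩⟩ := hcon
  obtain ⟨z, hz, hz'⟩ := hS.intermediate_value ha hb hu ⟨ha', hb'⟩
  exact h z hz hz'

variable {f : ℂ → ℂ} {Ω P : Set ℂ} {ρ : ℝ} {L : Set ℂ}

lemma MarkedCurve.pos (h : MarkedDomain f Ω P) (hL : MarkedCurve f Ω ρ L) : 0 < ρ := by
  obtain ⟨l, hl⟩ := hL.isConnected.nonempty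
  rw [← hL.norm_eq l hl]
  exact norm_pos_iff.2 (h.ne_zero l (hL.subset hl))

/-- Close to a level curve, `|f|` stays on one side of its level in each complementary component
of the curve. -/
theorem MarkedCurve.exists_sign (h : MarkedDomain f Ω P) (hL : MarkedCurve f Ω ρ L) {d : ℂ}
    (hd : d ∉ L) : ∃ U, IsOpen U ∧ L ⊆ U ∧
      ((∀ z ∈ U ∩ connectedComponentIn Lᶜ d, ρ < ‖f z‖) ∨
        (∀ z ∈ U ∩ connectedComponentIn Lᶜ d, ‖f z‖ < ρ)) := by
  have hρ := hL.pos h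
  have hLc := hL.isCompact.isClosed
  obtain ⟨l, hl⟩ := hL.isConnected.nonempty
  obtain ⟨R, hR, hLR⟩ := hL.isCompact.isBounded.subset_ball_lt 0 0
  set D := connectedComponentIn Lᶜ d with hD
  have hDo : IsOpen D := hLc.isOpen_compl.connectedComponentIn
  have hDc : IsConnected D := isConnected_connectedComponentIn_iff.2 hd
  have hDL : D ⊆ Lᶜ := connectedComponentIn_subset _ _
  obtain ⟨p, hpD, hp⟩ : ∃ p ∈ D, IsBounded D ∨ p ∉ Metric.closedBall 0 R := by
    by_cases hb : IsBounded D
    · exact ⟨d, mem_connectedComponentIn hd, .inl hb⟩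
    · obtain ⟨w, hw, hwR⟩ := Set.not_subset.1 (fun h : D ⊆ Metric.closedBall 0 R =>
        hb (Metric.isBounded_closedBall.subset h))
      exact ⟨w, hw, .inr hwR⟩
  -- `K` ties together all marks of the face `D` and, if `D` is unbounded, a point `p` outside a
  -- disc containing `L`.
  obtain ⟨K, hK, hKc, hFK, hKD⟩ := exists_isCompact_isConnected_subset hDo hDc
    (F := insert p (P ∩ D)) ((h.finite.inter_of_left D).insert p)
    (insert_subset hpD inter_subset_right)
  obtain ⟨U, hU, hLU, hUN, hUρ⟩ := hL.isolating (Ω ∩ Metric.ball 0 R ∩ Kᶜ)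
    ((h.isOpen.inter Metric.isOpen_ball).inter hK.isClosed.isOpen_compl)
    (fun x hx => ⟨⟨hL.subset hx, hLR hx⟩, fun hxK => hDL (hKD hxK) hx⟩)
  set V := connectedComponentIn U l with hV
  have hVo : IsOpen V := hU.connectedComponentIn
  have hlV : l ∈ V := mem_connectedComponentIn (hLU hl)
  have hVc : IsConnected V := isConnected_connectedComponentIn_iff.2 (hLU hl)
  have hLV : L ⊆ V := hL.isConnected.isPreconnected.subset_connectedComponentIn hl hLU
  have hVU : V ⊆ U := connectedComponentIn_subset _ _
  have hVN : closure V ⊆ Ω ∩ Metric.ball 0 R ∩ Kᶜ := (closure_mono hVU).trans hUN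
  have hVρ : ∀ z ∈ frontier V, ‖f z‖ ≠ ρ := by
    intro z hz
    refine hUρ z ⟨closure_mono hVU hz.1, ?_⟩
    have := frontier_component_subset hU.isClosed_compl l
    rw [compl_compl] at this
    rw [hU.interior_eq]
    exact this hz
  -- The frontier of `Q` is connected by unicoherence and avoids the level `ρ`, so `|f|` lies on one
  -- side of `ρ` there.
  set Q := connectedComponentIn (closure V)ᶜ p with hQ
  have hpK : p ∈ K := hFK (mem_insert _ _)
  have hKV : K ⊆ (closure V)ᶜ := fun x hx hxV => (hVN hxV).2 hx
  have hKQ : K ⊆ Q := hKc.isPreconnected.subset_connectedComponentIn hpK hKV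
  have hQo : IsOpen Q := isClosed_closure.isOpen_compl.connectedComponentIn
  have hVQ : Disjoint V (closure Q) := by
    refine Disjoint.closure_right ?_ hVo
    exact (disjoint_compl_right.mono_right (connectedComponentIn_subset _ _)).mono_left
      subset_closure
  have hQf : frontier Q ⊆ frontier V := by
    intro x hx
    refine ⟨frontier_component_subset isClosed_closure p hx, ?_⟩
    rw [hVo.interior_eq]
    exact fun hxV => Set.disjoint_left.1 hVQ hxV hx.1
  have hQc : IsPreconnected (frontier Q) :=
    isPreconnected_frontier_component isClosed_closure hVc.closure p
  have hQΩ : frontier Q ⊆ Ω := fun x hx => (hVN (hQf hx).1).1.1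
  -- The part of `D` between `L` and `Q`: bounded, free of marks since these lie in `K ⊆ Q`, and
  -- containing all points of `D` near `L`. The one-sided bound on its boundary passes inside.
  set O := D ∩ (closure Q)ᶜ with hO
  have hOo : IsOpen O := hDo.inter isClosed_closure.isOpen_compl
  have hOf : frontier O ⊆ L ∪ frontier Q := by
    refine (frontier_inter_subset _ _).trans (union_subset ?_ ?_)
    · exact inter_subset_left.trans ((frontier_component_subset hLc d).trans subset_union_left)
    · rw [frontier_compl]
      exact inter_subset_right.trans (frontier_closure_subset.trans subset_union_right)
  have hOb : IsBounded O := by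
    rcases hp with hp | hp
    · exact hp.subset inter_subset_left
    · refine (Metric.isBounded_closedBall (x := (0 : ℂ)) (r := R)).subset ?_
      have hVR : closure V ⊆ Metric.closedBall 0 R := fun x hx =>
        Metric.ball_subset_closedBall (hVN hx).1.2
      have := compl_closedBall_subset_component hR hVR (hKQ hpK) hp
      intro x hx
      by_contra hxR
      exact hx.2 (subset_closure (this hxR))
  have hOΩ : frontier O ⊆ Ω := hOf.trans (union_subset hL.subset hQΩ)
  have hOP : Disjoint O P := Set.disjoint_left.2 fun x hx hxP =>
    hx.2 (subset_closure (hKQ (hFK (.inr ⟨hxP, hx.1⟩))))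
  have hVO : V ∩ D ⊆ O := fun x hx => ⟨hx.2, Set.disjoint_left.1 hVQ hx.1⟩
  have hfc : ContinuousOn (fun z => ‖f z‖) (frontier Q) := fun z hz =>
    (h.analytic z (hQΩ hz)).continuousAt.norm.continuousWithinAt
  refine ⟨V, hVo, hLV, ?_⟩
  rcases forall_lt_or_forall_gt hQc hfc (fun z hz => hVρ z (hQf hz)) with hs | hs
  · left
    intro z hz
    refine h.lt_norm_of_frontier hOo hOb hOΩ hOP hρ (fun w hw => ?_) z (hVO hz)
    rcases hOf hw with hw | hw
    · exact (hL.norm_eq w hw).ge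
    · exact (hs w hw).le
  · right
    intro z hz
    refine h.norm_lt_of_frontier hOo hOb hOΩ hOP (fun w hw => ?_) z (hVO hz)
    rcases hOf hw with hw | hw
    · exact (hL.norm_eq w hw).le
    · exact (hs w hw).le

/-- Points close to a level curve where `|f|` is greater, respectively smaller, than its level lie
in different complementary components. -/
lemma MarkedCurve.component_ne (h : MarkedDomain f Ω P) (hL : MarkedCurve f Ω ρ L) {a b : ℂ}
    (ha : ∀ U, IsOpen U → L ⊆ U → ∃ w ∈ U, w ∈ connectedComponentIn Lᶜ a ∧ ρ < ‖f w‖)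
    (hb : ∀ U, IsOpen U → L ⊆ U → ∃ w ∈ U, w ∈ connectedComponentIn Lᶜ b ∧ ‖f w‖ < ρ) :
    connectedComponentIn Lᶜ a ≠ connectedComponentIn Lᶜ b := by
  intro hab
  have haL : a ∉ L := by
    obtain ⟨w, -, hw, -⟩ := ha univ isOpen_univ (subset_univ _)
    exact connectedComponentIn_nonempty_iff.1 ⟨w, hw⟩
  obtain ⟨U, hU, hLU, hs⟩ := hL.exists_sign h haL
  obtain ⟨w, hwU, hw, hw'⟩ := ha U hU hLU
  obtain ⟨v, hvU, hv, hv'⟩ := hb U hU hLU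
  rcases hs with hs | hs
  · exact lt_asymm hv' (hs v ⟨hvU, hab ▸ hv⟩)
  · exact lt_asymm hw' (hs w ⟨hwU, hw⟩)

/-- A level curve separates the plane. -/
theorem MarkedCurve.exists_bounded_face (h : MarkedDomain f Ω P) (hL : MarkedCurve f Ω ρ L) :
    ∃ a ∉ L, IsBounded (connectedComponentIn Lᶜ a) := by
  by_contra! hcon
  obtain ⟨l, hl⟩ := hL.isConnected.nonempty
  have hne : ∀ w, ‖f w‖ ≠ ρ → w ∉ L := fun w hw hwL => hw (hL.norm_eq w hwL)
  obtain ⟨a, -, ha⟩ := h.exists_norm_gt (hL.subset hl) univ_mem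
  rw [hL.norm_eq l hl] at ha
  -- Without bounded faces the complement is a single face, which near `l` contains values on both
  -- sides of `ρ`.
  have key : ∀ w ∉ L, w ∈ connectedComponentIn Lᶜ a := fun w hw => by
    rw [component_eq_of_not_isBounded hL.isCompact.isBounded (hcon a (hne a ha.ne')) (hcon w hw)]
    exact mem_connectedComponentIn hw
  refine hL.component_ne h (a := a) (b := a) (fun U hU hLU => ?_) (fun U hU hLU => ?_) rfl
  · obtain ⟨w, hwU, hw⟩ := h.exists_norm_gt (hL.subset hl) (hU.mem_nhds (hLU hl))
    rw [hL.norm_eq l hl] at hw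
    exact ⟨w, hwU, key w (hne w hw.ne'), hw⟩
  · obtain ⟨w, hwU, hw⟩ := h.exists_norm_lt (hL.subset hl) (hU.mem_nhds (hLU hl))
    rw [hL.norm_eq l hl] at hw
    exact ⟨w, hwU, key w (hne w hw.ne), hw⟩

/-- A level curve through a critical point has at least two bounded faces. -/
theorem MarkedCurve.exists_two_bounded_faces (h : MarkedDomain f Ω P)
    (hL : MarkedCurve f Ω ρ L) {z₀ : ℂ} (hz₀ : z₀ ∈ L) (hd : deriv f z₀ = 0) :
    ∃ a ∉ L, ∃ b ∉ L, IsBounded (connectedComponentIn Lᶜ a) ∧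
      IsBounded (connectedComponentIn Lᶜ b) ∧
      connectedComponentIn Lᶜ a ≠ connectedComponentIn Lᶜ b := by
  have hzΩ := hL.subset hz₀
  obtain ⟨ω, α, hω, hα, hα', h0, h1, h2, h3⟩ := exists_alternating_rays (h.analytic z₀ hzΩ)
    (h.ne_zero z₀ hzΩ) (h.nonconst z₀ hzΩ) hd
  rw [hL.norm_eq z₀ hz₀] at h0 h1 h2 h3
  obtain ⟨δ, hδ, hδ'⟩ := mem_nhdsGT_iff_exists_Ioc_subset.1 (h0.and (h1.and (h2.and h3)))
  have hδ : 0 < δ := hδ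
  set ray : ℝ → ℝ → ℂ := fun β t => z₀ + t * (ω * Complex.exp ((β : ℝ) * Complex.I)) with hray
  have hrayc : ∀ β, Continuous (ray β) := fun β => by fun_prop
  have hnear : ∀ β U, IsOpen U → L ⊆ U → ∃ t : ℝ, 0 < t ∧ t ≤ δ ∧ ray β t ∈ U := by
    intro β U hU hLU
    have h4 : Tendsto (ray β) (𝓝[>] 0) (𝓝 z₀) := by
      have := (hrayc β).tendsto 0
      simp only [hray, Complex.ofReal_zero, zero_mul, add_zero] at this
      exact this.mono_left nhdsWithin_le_nhds
    obtain ⟨t, ht, ht'⟩ := ((h4.eventually (hU.mem_nhds (hLU hz₀))).and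
      (Ioc_mem_nhdsGT hδ)).exists
    exact ⟨t, ht'.1, ht'.2, ht⟩
  have hne : ∀ w, ‖f w‖ ≠ ρ → w ∉ L := fun w hw hwL => hw (hL.norm_eq w hwL)
  have hδmem : δ ∈ Ioc 0 δ := ⟨hδ, le_rfl⟩
  have hcomp : ∀ β, (∀ t : ℝ, 0 < t → t ≤ δ → ray β t ∉ L) → ∀ t : ℝ, 0 < t → t ≤ δ →
      ray β t ∈ connectedComponentIn Lᶜ (ray β δ) := by
    intro β hβ t ht ht'
    refine (isPreconnected_Ioc.image (ray β)
      (hrayc β).continuousOn).subset_connectedComponentIn (mem_image_of_mem _ hδmem) ?_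
      (mem_image_of_mem _ ⟨ht, ht'⟩)
    rintro _ ⟨s, hs, rfl⟩
    exact hβ s hs.1 hs.2
  have s0 : ∀ t : ℝ, 0 < t → t ≤ δ → ρ < ‖f (ray 0 t)‖ := fun t ht ht' => (hδ' ⟨ht, ht'⟩).1
  have s1 : ∀ t : ℝ, 0 < t → t ≤ δ → ‖f (ray α t)‖ < ρ := fun t ht ht' => (hδ' ⟨ht, ht'⟩).2.1
  have s2 : ∀ t : ℝ, 0 < t → t ≤ δ → ρ < ‖f (ray (2 * α) t)‖ :=
    fun t ht ht' => (hδ' ⟨ht, ht'⟩).2.2.1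
  have s3 : ∀ t : ℝ, 0 < t → t ≤ δ → ‖f (ray (3 * α) t)‖ < ρ :=
    fun t ht ht' => (hδ' ⟨ht, ht'⟩).2.2.2
  have m0 := hcomp 0 fun t ht ht' => hne _ (s0 t ht ht').ne'
  have m1 := hcomp α fun t ht ht' => hne _ (s1 t ht ht').ne
  have m2 := hcomp (2 * α) fun t ht ht' => hne _ (s2 t ht ht').ne'
  have m3 := hcomp (3 * α) fun t ht ht' => hne _ (s3 t ht ht').ne
  have hsep : ∀ β β', (∀ t : ℝ, 0 < t → t ≤ δ → ρ < ‖f (ray β t)‖) →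
      (∀ t : ℝ, 0 < t → t ≤ δ → ‖f (ray β' t)‖ < ρ) →
      connectedComponentIn Lᶜ (ray β δ) ≠ connectedComponentIn Lᶜ (ray β' δ) := by
    intro β β' hs hs'
    refine hL.component_ne h (fun U hU hLU => ?_) (fun U hU hLU => ?_)
    · obtain ⟨t, ht, ht', htU⟩ := hnear β U hU hLU
      exact ⟨_, htU, hcomp β (fun t ht ht' => hne _ (hs t ht ht').ne') t ht ht', hs t ht ht'⟩
    · obtain ⟨t, ht, ht', htU⟩ := hnear β' U hU hLU
      exact ⟨_, htU, hcomp β' (fun t ht ht' => hne _ (hs' t ht ht').ne) t ht ht', hs' t ht ht'⟩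
  -- At most one of three distinct faces is unbounded.
  have hthree : ∀ a ∉ L, ∀ b ∉ L, ∀ c ∉ L,
      connectedComponentIn Lᶜ a ≠ connectedComponentIn Lᶜ b →
      connectedComponentIn Lᶜ a ≠ connectedComponentIn Lᶜ c →
      connectedComponentIn Lᶜ b ≠ connectedComponentIn Lᶜ c →
      ∃ a ∉ L, ∃ b ∉ L, IsBounded (connectedComponentIn Lᶜ a) ∧
        IsBounded (connectedComponentIn Lᶜ b) ∧
        connectedComponentIn Lᶜ a ≠ connectedComponentIn Lᶜ b := by
    intro a ha b hb c hc hab hac hbc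
    have hLb := hL.isCompact.isBounded
    by_cases hba : IsBounded (connectedComponentIn Lᶜ a)
    · by_cases hbb : IsBounded (connectedComponentIn Lᶜ b)
      · exact ⟨a, ha, b, hb, hba, hbb, hab⟩
      · by_cases hbc' : IsBounded (connectedComponentIn Lᶜ c)
        · exact ⟨a, ha, c, hc, hba, hbc', hac⟩
        · exact (hbc (component_eq_of_not_isBounded hLb hbb hbc')).elim
    · refine ⟨b, hb, c, hc, ?_, ?_, hbc⟩
      · by_contra hbb
        exact hab (component_eq_of_not_isBounded hLb hba hbb)
      · by_contra hbc'
        exact hac (component_eq_of_not_isBounded hLb hba hbc')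
  have n0 := hne _ (s0 δ hδ le_rfl).ne'
  have n1 := hne _ (s1 δ hδ le_rfl).ne
  have n2 := hne _ (s2 δ hδ le_rfl).ne'
  have n3 := hne _ (s3 δ hδ le_rfl).ne
  -- Rays of opposite sign lie in different faces. If two rays of equal sign do too, there are three
  -- faces; otherwise two disjoint faces contain alternating rays.
  by_cases h02 : connectedComponentIn Lᶜ (ray 0 δ) = connectedComponentIn Lᶜ (ray (2 * α) δ)
  · by_cases h13 : connectedComponentIn Lᶜ (ray α δ) = connectedComponentIn Lᶜ (ray (3 * α) δ)
    · exfalso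
      have hz : ∀ a, z₀ ∉ connectedComponentIn Lᶜ a := fun a ha =>
        connectedComponentIn_subset _ _ ha hz₀
      refine false_of_alternating_rays (hL.isCompact.isClosed.isOpen_compl.connectedComponentIn)
        (isConnected_connectedComponentIn_iff.2 n0)
        (isPreconnected_connectedComponentIn (x := ray α δ)) ?_ (hz _) (hz _)
        hω hα hα' hδ m0 m1 (h02 ▸ m2) (h13 ▸ m3)
      rw [Set.disjoint_left]
      intro x hx hx'
      exact hsep 0 α s0 s1 ((connectedComponentIn_eq hx).trans (connectedComponentIn_eq hx').symm)
    · exact hthree _ n1 _ n3 _ n0 h13 (hsep 0 α s0 s1).symm (hsep 0 (3 * α) s0 s3).symm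
  · exact hthree _ n0 _ n2 _ n1 h02 (hsep 0 α s0 s1) (hsep (2 * α) α s2 s1)

/-! ### Filled curves and counting -/

/-- The union of a set with the bounded components of its complement. -/
def hull (L : Set ℂ) : Set ℂ := {z | IsBounded (connectedComponentIn Lᶜ z)}

/-- For `z ∈ L` the set `connectedComponentIn Lᶜ z` is empty, hence bounded. -/
lemma subset_hull (L : Set ℂ) : L ⊆ hull L := by
  intro z hz
  have : z ∉ Lᶜ := fun h => h hz
  simp [hull, connectedComponentIn_eq_empty this]

lemma isClosed_hull {L : Set ℂ} (hL : IsClosed L) : IsClosed (hull L) := by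
  rw [← isOpen_compl_iff, isOpen_iff_mem_nhds]
  intro z hz
  have hzL : z ∉ L := fun h => hz (subset_hull L h)
  refine mem_of_superset (hL.isOpen_compl.connectedComponentIn.mem_nhds
    (mem_connectedComponentIn hzL)) fun w hw hwL => hz ?_
  rw [hull, mem_ofPred_eq, connectedComponentIn_eq hw]
  exact hwL

lemma frontier_hull_subset {L : Set ℂ} (hL : IsClosed L) : frontier (hull L) ⊆ L := by
  intro z hz
  by_contra hzL
  refine hz.2 (mem_interior.2 ⟨connectedComponentIn Lᶜ z, fun w hw => ?_,
    hL.isOpen_compl.connectedComponentIn, mem_connectedComponentIn hzL⟩)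
  have : z ∈ hull L := (isClosed_hull hL).closure_eq ▸ hz.1
  rw [hull, mem_ofPred_eq, ← connectedComponentIn_eq hw]
  exact this

lemma isBounded_hull {L : Set ℂ} (hL : IsBounded L) : IsBounded (hull L) := by
  obtain ⟨R, hR, hLR⟩ := hL.subset_closedBall_lt 0 0
  refine (Metric.isBounded_closedBall (x := (0 : ℂ)) (r := R)).subset fun z hz => ?_
  by_contra hzR
  refine not_isBounded_compl_closedBall R (IsBounded.subset hz ?_)
  exact compl_closedBall_subset_component hR hLR
    (mem_connectedComponentIn fun h => hzR (hLR h)) hzR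

/-- Two disjoint compact connected sets with intersecting hulls are nested. -/
lemma nested_of_mem_hull {L₁ L₂ : Set ℂ} (h₁ : IsClosed L₁)
    (c₁ : IsConnected L₁) (hd : Disjoint L₁ L₂) {z : ℂ} (hz₁ : z ∈ hull L₁)
    (hz₂ : z ∈ hull L₂) :
    (∃ a ∈ L₁, IsBounded (connectedComponentIn L₂ᶜ a)) ∨
    (∃ a ∈ L₂, IsBounded (connectedComponentIn L₁ᶜ a)) := by
  by_contra! hcon
  obtain ⟨hc₁, hc₂⟩ := hcon
  obtain ⟨a, ha⟩ := c₁.nonempty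
  -- The bounded face of `L₁` at `z` misses `L₂`, so with `L₁` it joins `z` to `a` off `L₂`; hence
  -- `a` lies in a bounded face of `L₂`.
  have hdis : Disjoint (connectedComponentIn L₁ᶜ z) L₂ := by
    rw [Set.disjoint_left]
    intro y hy hyL
    refine hc₂ y hyL ?_
    rw [← connectedComponentIn_eq hy]
    exact hz₁
  have hsub : connectedComponentIn L₁ᶜ z ∪ L₁ ⊆ connectedComponentIn L₂ᶜ a :=
    (isPreconnected_component_union h₁ c₁ z).subset_connectedComponentIn (.inr ha)
      (union_subset hdis.subset_compl_right hd.subset_compl_right)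
  have hz : z ∈ connectedComponentIn L₁ᶜ z ∪ L₁ := by
    by_cases hzL : z ∈ L₁
    · exact .inr hzL
    · exact .inl (mem_connectedComponentIn hzL)
  refine hc₁ a ha ?_
  rw [connectedComponentIn_eq (hsub hz)]
  exact hz₂

/-- If a compact connected set lies in a bounded complementary component, so does its hull. -/
lemma hull_subset_component {L₁ L₂ : Set ℂ} (h₁ : IsCompact L₁) (c₁ : IsConnected L₁)
    (c₂ : IsConnected L₂) (hd : Disjoint L₁ L₂) {a : ℂ} (ha : a ∈ L₁)
    (hb : IsBounded (connectedComponentIn L₂ᶜ a)) : hull L₁ ⊆ connectedComponentIn L₂ᶜ a := by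
  have key : ∀ w, Disjoint (connectedComponentIn L₁ᶜ w) L₂ →
      connectedComponentIn L₁ᶜ w ∪ L₁ ⊆ connectedComponentIn L₂ᶜ a := fun w hw =>
    (isPreconnected_component_union h₁.isClosed c₁ w).subset_connectedComponentIn (.inr ha)
      (union_subset hw.subset_compl_right hd.subset_compl_right)
  have hmem : ∀ w, w ∈ connectedComponentIn L₁ᶜ w ∪ L₁ := fun w => by
    by_cases hw : w ∈ L₁
    · exact .inr hw
    · exact .inl (mem_connectedComponentIn hw)
  intro z hz
  by_cases hdis : Disjoint (connectedComponentIn L₁ᶜ z) L₂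
  · exact key z hdis (hmem z)
  exfalso
  obtain ⟨y, hy, hyL⟩ := Set.not_disjoint_iff.1 hdis
  have hL₂ : L₂ ⊆ connectedComponentIn L₁ᶜ z := by
    rw [connectedComponentIn_eq hy]
    exact c₂.isPreconnected.subset_connectedComponentIn hyL hd.subset_compl_left
  -- Here `L₂` lies in a bounded face of `L₁`. The unbounded face of `L₁` thus avoids `L₂` and joins
  -- `w` to `L₁`, which puts `w` in the face of `a` after all.
  obtain ⟨w, hw⟩ : ∃ w, w ∉ connectedComponentIn L₂ᶜ a ∪ hull L₁ := by
    by_contra! hcon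
    refine NormedSpace.unbounded_univ ℂ ℂ ?_
    rw [← eq_univ_of_forall hcon]
    exact hb.union (isBounded_hull h₁.isBounded)
  refine hw (.inl (key w ?_ (hmem w)))
  rw [Set.disjoint_left]
  intro x hx hxL
  refine hw (.inr ?_)
  rw [hull, mem_ofPred_eq, connectedComponentIn_eq hx, ← connectedComponentIn_eq (hL₂ hxL)]
  exact hz

/-- A family of disjoint compact connected sets is finite if each of them encloses one of finitely
many points, and each of them encloses more of these points than those inside it. -/
theorem finite_of_marks {P : Set ℂ} (hP : P.Finite) {𝒮 : Set (Set ℂ)}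
    (hcomp : ∀ L ∈ 𝒮, IsCompact L) (hconn : ∀ L ∈ 𝒮, IsConnected L)
    (hdisj : 𝒮.PairwiseDisjoint id) (hmark : ∀ L ∈ 𝒮, ∃ p ∈ P, p ∈ hull L)
    (hmore : ∀ L₁ ∈ 𝒮, ∀ L₂ ∈ 𝒮, Disjoint L₁ L₂ → ∀ a ∈ L₁,
      IsBounded (connectedComponentIn L₂ᶜ a) → ∃ p ∈ P, p ∈ hull L₂ ∧ p ∉ hull L₁) :
    𝒮.Finite := by
  refine Set.Finite.of_finite_image (f := fun L => P ∩ hull L)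
    (hP.finite_subsets.subset ?_) ?_
  · rintro _ ⟨L, -, rfl⟩
    exact inter_subset_left
  · intro L₁ hL₁ L₂ hL₂ heq
    by_contra hne
    have hd : Disjoint L₁ L₂ := hdisj hL₁ hL₂ hne
    have heq : P ∩ hull L₁ = P ∩ hull L₂ := heq
    obtain ⟨p, hp, hp₁⟩ := hmark L₁ hL₁
    have hp₂ : p ∈ hull L₂ := (heq ▸ (⟨hp, hp₁⟩ : p ∈ P ∩ hull L₁) : p ∈ P ∩ hull L₂).2
    rcases nested_of_mem_hull (hcomp _ hL₁).isClosed (hconn _ hL₁)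
      hd hp₁ hp₂ with ⟨a, ha, hb⟩ | ⟨a, ha, hb⟩
    · obtain ⟨q, hq, hq₂, hq₁⟩ := hmore L₁ hL₁ L₂ hL₂ hd a ha hb
      exact hq₁ (heq ▸ (⟨hq, hq₂⟩ : q ∈ P ∩ hull L₂) : q ∈ P ∩ hull L₁).2
    · obtain ⟨q, hq, hq₂, hq₁⟩ := hmore L₂ hL₂ L₁ hL₁ hd.symm a ha hb
      exact hq₁ (heq ▸ (⟨hq, hq₂⟩ : q ∈ P ∩ hull L₁) : q ∈ P ∩ hull L₂).2

/-- Every bounded face of a level curve contains a marked point. -/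
lemma MarkedCurve.exists_mark (h : MarkedDomain f Ω P) (hL : MarkedCurve f Ω ρ L) {a : ℂ}
    (ha : a ∉ L) (hb : IsBounded (connectedComponentIn Lᶜ a)) :
    ∃ p ∈ P, p ∈ connectedComponentIn Lᶜ a := by
  have hf := frontier_component_subset hL.isCompact.isClosed a
  exact h.exists_mark hL.isCompact.isClosed.isOpen_compl.connectedComponentIn
    ⟨a, mem_connectedComponentIn ha⟩ hb (hf.trans hL.subset) (hL.pos h)
    fun z hz => hL.norm_eq z (hf hz)

lemma component_subset_hull {a : ℂ} (hb : IsBounded (connectedComponentIn Lᶜ a)) :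
    connectedComponentIn Lᶜ a ⊆ hull L := fun w hw => by
  rw [hull, mem_ofPred_eq, ← connectedComponentIn_eq hw]
  exact hb

lemma MarkedCurve.exists_mark_hull (h : MarkedDomain f Ω P) (hL : MarkedCurve f Ω ρ L) :
    ∃ p ∈ P, p ∈ hull L := by
  obtain ⟨a, ha, hb⟩ := hL.exists_bounded_face h
  obtain ⟨p, hp, hpa⟩ := hL.exists_mark h ha hb
  exact ⟨p, hp, component_subset_hull hb hpa⟩

/-- There are only finitely many level curves at each level. -/
theorem finite_level_curves (h : MarkedDomain f Ω P) {𝒮 : Set (Set ℂ)}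
    (h𝒮 : ∀ L ∈ 𝒮, MarkedCurve f Ω ρ L) (hdisj : 𝒮.PairwiseDisjoint id) : 𝒮.Finite := by
  refine finite_of_marks h.finite (fun L hL => (h𝒮 L hL).isCompact)
    (fun L hL => (h𝒮 L hL).isConnected) hdisj (fun L hL => (h𝒮 L hL).exists_mark_hull h) ?_
  intro L₁ hL₁ L₂ hL₂ hd a ha hb
  have m₁ := h𝒮 L₁ hL₁
  have m₂ := h𝒮 L₂ hL₂
  have haL : a ∉ L₂ := Set.disjoint_left.1 hd ha
  have hsub := hull_subset_component m₁.isCompact m₁.isConnected m₂.isConnected hd ha hb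
  have hA : IsOpen (connectedComponentIn L₂ᶜ a) :=
    m₂.isCompact.isClosed.isOpen_compl.connectedComponentIn
  have hH := isClosed_hull m₁.isCompact.isClosed
  have hf : frontier (connectedComponentIn L₂ᶜ a ∩ (hull L₁)ᶜ) ⊆ L₂ ∪ L₁ := by
    refine (frontier_inter_subset _ _).trans (union_subset_union ?_ ?_)
    · exact inter_subset_left.trans (frontier_component_subset m₂.isCompact.isClosed a)
    · rw [frontier_compl]
      exact inter_subset_right.trans (frontier_hull_subset m₁.isCompact.isClosed)
  -- Otherwise the bounded face would be both open and closed.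
  have hne : (connectedComponentIn L₂ᶜ a ∩ (hull L₁)ᶜ).Nonempty := by
    by_contra hcon
    have heq : connectedComponentIn L₂ᶜ a = hull L₁ := by
      refine subset_antisymm (fun x hx => ?_) hsub
      by_contra hxH
      exact hcon ⟨x, hx, hxH⟩
    have hclopen : IsClopen (connectedComponentIn L₂ᶜ a) := ⟨heq ▸ hH, hA⟩
    have := hclopen.eq_univ ⟨a, mem_connectedComponentIn haL⟩
    exact NormedSpace.unbounded_univ ℂ ℂ (this ▸ hb)
  obtain ⟨p, hp, hpO⟩ := h.exists_mark (hA.inter hH.isOpen_compl) hne (hb.subset inter_subset_left)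
    (hf.trans (union_subset m₂.subset m₁.subset)) (m₁.pos h) (fun z hz =>
      (hf hz).elim (m₂.norm_eq z) (m₁.norm_eq z))
  exact ⟨p, hp, component_subset_hull hb hpO.1, hpO.2⟩

/-- There are only finitely many level curves through critical points. -/
theorem finite_critical_curves (h : MarkedDomain f Ω P) {𝒮 : Set (Set ℂ)}
    (h𝒮 : ∀ L ∈ 𝒮, (∃ ρ, MarkedCurve f Ω ρ L) ∧ ∃ z ∈ L, deriv f z = 0)
    (hdisj : 𝒮.PairwiseDisjoint id) : 𝒮.Finite := by
  refine finite_of_marks h.finite (fun L hL => (h𝒮 L hL).1.choose_spec.isCompact)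
    (fun L hL => (h𝒮 L hL).1.choose_spec.isConnected) hdisj
    (fun L hL => (h𝒮 L hL).1.choose_spec.exists_mark_hull h) ?_
  intro L₁ hL₁ L₂ hL₂ hd a ha hb
  obtain ⟨ρ₁, m₁⟩ := (h𝒮 L₁ hL₁).1
  obtain ⟨⟨ρ₂, m₂⟩, z, hz, hdz⟩ := h𝒮 L₂ hL₂
  have hsub := hull_subset_component m₁.isCompact m₁.isConnected m₂.isConnected hd ha hb
  obtain ⟨b, hbL, hbb, hba⟩ : ∃ b ∉ L₂, IsBounded (connectedComponentIn L₂ᶜ b) ∧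
      connectedComponentIn L₂ᶜ b ≠ connectedComponentIn L₂ᶜ a := by
    obtain ⟨b, hb, c, hc, hbb, hcb, hbc⟩ := m₂.exists_two_bounded_faces h hz hdz
    by_cases hba : connectedComponentIn L₂ᶜ b = connectedComponentIn L₂ᶜ a
    · exact ⟨c, hc, hcb, fun hca => hbc (hba.trans hca.symm)⟩
    · exact ⟨b, hb, hbb, hba⟩
  obtain ⟨p, hp, hpb⟩ := m₂.exists_mark h hbL hbb
  exact ⟨p, hp, component_subset_hull hbb hpb, fun hp₁ => hba
    ((connectedComponentIn_eq hpb).trans (connectedComponentIn_eq (hsub hp₁)).symm)⟩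

/-! ### Level curves of meromorphic functions -/

variable {f : ℂ → ℂ} {G G' : Set ℂ}

lemma modulus_of_analyticAt {z : ℂ} (h : AnalyticAt ℂ f z) : modulus f z = ‖f z‖ₑ :=
  if_neg (not_lt.2 h.meromorphicOrderAt_nonneg)

lemma analyticAt_of_modulus_ne_top {z : ℂ} (hf : MeromorphicNFAt f z) (h : modulus f z ≠ ⊤) :
    AnalyticAt ℂ f z := by
  rw [← hf.meromorphicOrderAt_nonneg_iff_analyticAt]
  by_contra! hlt
  exact h (if_pos hlt)

/-- At a pole `|f| → ∞`, matching the assigned value `⊤`; elsewhere the normal form is analytic. -/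
lemma continuousAt_modulus {z : ℂ} (hf : MeromorphicNFAt f z) : ContinuousAt (modulus f) z := by
  by_cases h : meromorphicOrderAt f z < 0
  · have htop : modulus f z = ⊤ := if_pos h
    rw [continuousAt_iff_punctured_nhds, htop, ENNReal.tendsto_nhds_top_iff_nnreal]
    intro x
    have h1 := tendsto_norm_cobounded_atTop.comp (tendsto_cobounded_of_meromorphicOrderAt_neg h)
    filter_upwards [hf.meromorphicAt.eventually_analyticAt, h1.eventually_gt_atTop (x : ℝ)]
      with w hw hx
    rw [modulus_of_analyticAt hw, ← ofReal_norm, ← ENNReal.ofReal_coe_nnreal]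
    exact (ENNReal.ofReal_lt_ofReal_iff_of_nonneg x.2).2 hx
  · have ha := hf.meromorphicOrderAt_nonneg_iff_analyticAt.1 (not_lt.1 h)
    refine ContinuousAt.congr (f := fun w => ‖f w‖ₑ) ha.continuousAt.enorm ?_
    filter_upwards [ha.eventually_analyticAt] with w hw using (modulus_of_analyticAt hw).symm

/-- Distinct level curves are disjoint. -/
lemma pairwiseDisjoint_levelCurves {𝒮 : Set (Set ℂ)} (h : ∀ L ∈ 𝒮, IsLevelCurve f G' L) :
    𝒮.PairwiseDisjoint id := by
  intro L₁ h₁ L₂ h₂ hne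
  obtain ⟨ε₁, z₁, hz₁, rfl⟩ := h L₁ h₁
  obtain ⟨ε₂, z₂, hz₂, rfl⟩ := h L₂ h₂
  rw [Function.onFun, Set.disjoint_left]
  intro w hw₁ hw₂
  have e₁ := (connectedComponentIn_subset _ _ hw₁).2
  have e₂ := (connectedComponentIn_subset _ _ hw₂).2
  obtain rfl : ε₁ = ε₂ := e₁.symm.trans e₂
  exact hne ((connectedComponentIn_eq hw₁).trans (connectedComponentIn_eq hw₂).symm)

/-- If no level curve in `G` is unbounded or touches the boundary, `f` is nowhere locally
constant in `G`. -/
lemma not_eventually_const (hG_open : IsOpen G) (hG_conn : IsConnected G)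
    (hGG' : G ⊆ G') (hf : MeromorphicNFOn f G')
    (h_curve_bdd : ∀ L : Set ℂ, IsLevelCurve f G' L → L ⊆ G → IsBounded L)
    (h_curve_bdry : ∀ z ∈ G, closure (levelCurveThrough f G' z) ⊆ G) {z : ℂ} (hz : z ∈ G)
    (c : ℂ) : ¬ ∀ᶠ w in 𝓝[≠] z, f w = c := by
  intro hc
  have hmer : MeromorphicOn (fun w => f w - c) G := fun w hw =>
    (hf (hGG' hw)).meromorphicAt.sub (MeromorphicAt.const c w)
  have htop : meromorphicOrderAt (fun w => f w - c) z = ⊤ :=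
    meromorphicOrderAt_eq_top_iff.2 (hc.mono fun w hw => sub_eq_zero.2 hw)
  have hmod : ∀ w ∈ G, modulus f w = ‖c‖ₑ := by
    intro w hw
    have hw' : meromorphicOrderAt (fun w => f w - c) w = ⊤ := by
      by_contra hne
      exact hmer.meromorphicOrderAt_ne_top_of_isPreconnected hG_conn.isPreconnected hw hz hne htop
    have h1 : f =ᶠ[𝓝[≠] w] fun _ => c :=
      (meromorphicOrderAt_eq_top_iff.1 hw').mono fun v hv => sub_eq_zero.1 hv
    have h2 : f =ᶠ[𝓝 w] fun _ => c :=
      ((hf (hGG' hw)).eventuallyEq_nhdsNE_iff_eventuallyEq_nhds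
        analyticAt_const.meromorphicNFAt).1 h1
    rw [modulus_of_analyticAt (analyticAt_const.congr h2.symm), h2.self_of_nhds]
  have hzset : z ∈ levelSet f G' (modulus f z) := ⟨hGG' hz, rfl⟩
  -- By the identity theorem all of `G` lies in one level curve. Its closure stays in `G`, so `G` is
  -- clopen, hence the plane, contradicting boundedness of the curve.
  have hGL : G ⊆ levelCurveThrough f G' z :=
    hG_conn.isPreconnected.subset_connectedComponentIn hz fun w hw =>
      ⟨hGG' hw, (hmod w hw).trans (hmod z hz).symm⟩
  have hcl : closure G ⊆ G := (closure_mono hGL).trans (h_curve_bdry z hz)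
  have huniv : G = univ :=
    IsClopen.eq_univ ⟨closure_subset_iff_isClosed.1 hcl, hG_open⟩ hG_conn.nonempty
  have hb := h_curve_bdd (levelCurveThrough f G' z) ⟨_, z, hzset, rfl⟩
    (subset_closure.trans (h_curve_bdry z hz))
  exact NormedSpace.unbounded_univ ℂ ℂ (huniv ▸ hb.subset hGL)

/-- The zeros and poles of `f` in `G`. -/
def zerosAndPoles (f : ℂ → ℂ) (G : Set ℂ) : Set ℂ := {z ∈ G | modulus f z = 0 ∨ modulus f z = ⊤}

/-- The limit `1` at infinity bounds the set. Infinitely many points would accumulate in `closure G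
⊆ G'`, where `f` is still meromorphic, forcing `f` to vanish on an open piece of `G`. -/
lemma finite_zerosAndPoles (hGG' : closure G ⊆ G') (hf : MeromorphicNFOn f G')
    (hf_lim : ¬ IsBounded G → Tendsto (modulus f) (cobounded ℂ ⊓ 𝓟 G) (𝓝 1))
    (hnc : ∀ z ∈ G, ∀ c : ℂ, ¬ ∀ᶠ w in 𝓝[≠] z, f w = c) : (zerosAndPoles f G).Finite := by
  have hbdd : IsBounded (zerosAndPoles f G) := by
    by_cases hG : IsBounded G
    · exact hG.subset fun z hz => hz.1
    · have h1 : ∀ᶠ x : ℝ≥0∞ in 𝓝 1, x ∈ Ioo 0 ⊤ :=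
        Ioo_mem_nhds zero_lt_one ENNReal.one_lt_top
      have h2 := eventually_inf_principal.1 ((hf_lim hG).eventually h1)
      rw [isBounded_def]
      filter_upwards [h2] with w hw hwZ
      rcases hwZ.2 with h | h
      · exact (hw hwZ.1).1.ne' h
      · exact (hw hwZ.1).2.ne h
  by_contra hinf
  obtain ⟨x, hx, hacc⟩ := Set.Infinite.exists_accPt_of_subset_isCompact hinf
    hbdd.isCompact_closure subset_closure
  have hxG : x ∈ closure G := closure_mono (fun z hz => hz.1) hx
  have hm := (hf (hGG' hxG)).meromorphicAt
  have hfreq : ∃ᶠ w in 𝓝[≠] x, w ∈ zerosAndPoles f G := accPt_iff_frequently_nhdsNE.1 hacc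
  rcases hm.eventually_eq_zero_or_eventually_ne_zero with h | h
  · have h' := eventually_eventually_nhdsWithin.2 h
    obtain ⟨w, hw, hw', hwx⟩ := (hfreq.and_eventually (h'.and self_mem_nhdsWithin)).exists
    rw [isOpen_compl_singleton.nhdsWithin_eq hwx] at hw'
    exact hnc w hw.1 0 (hw'.filter_mono nhdsWithin_le_nhds)
  · obtain ⟨w, hw, hw', ha⟩ := (hfreq.and_eventually (h.and hm.eventually_analyticAt)).exists
    have := hw.2
    rw [modulus_of_analyticAt ha] at this
    simp [hw'] at this

/-- The zeros and poles of `f` together with points of the bounded components of the complement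
of `G` serve as marked points. -/
lemma exists_markedDomain (hG_open : IsOpen G) (hGG' : closure G ⊆ G')
    (hf : MeromorphicNFOn f G') (hG_compl : {K ∈ componentsOf Gᶜ | IsBounded K}.Finite)
    (hnc : ∀ z ∈ G, ∀ c : ℂ, ¬ ∀ᶠ w in 𝓝[≠] z, f w = c) (hfin : (zerosAndPoles f G).Finite) :
    ∃ P, MarkedDomain f (G \ zerosAndPoles f G) P := by
  have hch : ∀ K ∈ {K ∈ componentsOf Gᶜ | IsBounded K}, ∃ p, p ∈ K := by
    rintro K ⟨⟨z, hz, rfl⟩, -⟩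
    exact ⟨z, mem_connectedComponentIn hz⟩
  choose! p hp using hch
  have hΩ : ∀ z ∈ G \ zerosAndPoles f G, AnalyticAt ℂ f z := fun z hz =>
    analyticAt_of_modulus_ne_top (hf (hGG' (subset_closure hz.1))) fun h => hz.2 ⟨hz.1, .inr h⟩
  refine ⟨zerosAndPoles f G ∪ p '' {K ∈ componentsOf Gᶜ | IsBounded K},
    hG_open.sdiff hfin.isClosed, hfin.union (hG_compl.image p), hΩ, ?_, ?_, ?_⟩
  · intro z hz h0
    refine hz.2 ⟨hz.1, .inl ?_⟩
    rw [modulus_of_analyticAt (hΩ z hz), h0, enorm_zero]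
  · exact fun z hz hc => hnc z hz.1 _ (hc.filter_mono nhdsWithin_le_nhds)
  · intro O hO hOb hOf hOP x hx
    refine ⟨?_, fun hxZ => Set.disjoint_left.1 hOP hx (.inl hxZ)⟩
    by_contra hxG
    -- A component of `Gᶜ` cannot cross the frontier of `O`, which lies in `G`; so it is bounded and
    -- its mark lies in `O`.
    have hKO : connectedComponentIn Gᶜ x ⊆ O := by
      refine isPreconnected_connectedComponentIn.subset_left_of_subset_union hO
        isClosed_closure.isOpen_compl (disjoint_compl_right.mono_left subset_closure)
        (fun y hy => ?_) ⟨x, mem_connectedComponentIn hxG, hx⟩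
      by_cases hyO : y ∈ O
      · exact .inl hyO
      · refine .inr fun hyc => connectedComponentIn_subset _ _ hy (hOf ⟨hyc, ?_⟩).1
        rwa [hO.interior_eq]
    have hK : connectedComponentIn Gᶜ x ∈ {K ∈ componentsOf Gᶜ | IsBounded K} :=
      ⟨⟨x, hxG, rfl⟩, hOb.subset hKO⟩
    exact Set.disjoint_left.1 hOP (hKO (hp _ hK)) (.inr (mem_image_of_mem p hK))

/-- A level curve in `G` which does not consist of zeros or poles is a marked curve. -/
lemma markedCurve_of_levelCurve (hGG' : closure G ⊆ G') (hf : MeromorphicNFOn f G') {P : Set ℂ}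
    (hP : MarkedDomain f (G \ zerosAndPoles f G) P)
    (h_curve_bdd : ∀ L : Set ℂ, IsLevelCurve f G' L → L ⊆ G → IsBounded L)
    (h_curve_bdry : ∀ z ∈ G, closure (levelCurveThrough f G' z) ⊆ G) {ε : ℝ≥0∞} (h0 : ε ≠ 0)
    (htop : ε ≠ ⊤) {L : Set ℂ} (hL : L ∈ componentsOf (levelSet f G' ε)) (hLG : L ⊆ G) :
    MarkedCurve f (G \ zerosAndPoles f G) ε.toReal L := by
  have hb := h_curve_bdd L ⟨ε, hL⟩ hLG
  obtain ⟨z, hz, rfl⟩ := hL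
  have hzL := mem_connectedComponentIn hz
  have hclG : closure (connectedComponentIn (levelSet f G' ε) z) ⊆ G := by
    have := h_curve_bdry z (hLG hzL)
    rwa [levelCurveThrough, hz.2] at this
  have hmod : ∀ w ∈ closure (connectedComponentIn (levelSet f G' ε) z), modulus f w = ε := by
    intro w hw
    have hc := continuousAt_modulus (hf (hGG' (subset_closure (hclG hw))))
    by_contra hne
    obtain ⟨v, hv, hv'⟩ := mem_closure_iff_nhds.1 hw _ (hc.eventually_ne hne)
    exact hv (connectedComponentIn_subset _ _ hv').2
  have hclosed : IsClosed (connectedComponentIn (levelSet f G' ε) z) := by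
    refine closure_subset_iff_isClosed.1
      (isPreconnected_connectedComponentIn.closure.subset_connectedComponentIn
        (subset_closure hzL) fun w hw => ⟨hGG' (subset_closure (hclG hw)), hmod w hw⟩)
  have hcomp := Metric.isCompact_of_isClosed_isBounded hclosed hb
  have hnorm : ∀ w ∈ G \ zerosAndPoles f G, (modulus f w = ε ↔ ‖f w‖ = ε.toReal) := by
    intro w hw
    rw [modulus_of_analyticAt (hP.analytic w hw), ← toReal_enorm,
      ENNReal.toReal_eq_toReal_iff' enorm_ne_top htop]
  have hsub : connectedComponentIn (levelSet f G' ε) z ⊆ G \ zerosAndPoles f G := by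
    refine fun w hw => ⟨hLG hw, fun hwZ => ?_⟩
    have := hmod w (subset_closure hw)
    rcases hwZ.2 with h | h
    · exact h0 (this.symm.trans h)
    · exact htop (this.symm.trans h)
  refine ⟨hcomp, isConnected_connectedComponentIn_iff.2 hz, hsub,
    fun w hw => (hnorm w (hsub hw)).1 (hmod w (subset_closure hw)), fun N hN hLN => ?_⟩
  obtain ⟨N₀, hN₀, hLN₀, hN₀N, hN₀c⟩ := exists_open_between_and_isCompact_closure hcomp
    (hN.inter hP.isOpen) (subset_inter hLN hsub)
  -- A compact piece of the level set in which the curve is still a full component. As `U ⊆ N₀`, a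
  -- frontier of `U` avoiding `K` avoids the whole level.
  set K := {w ∈ closure N₀ | ‖f w‖ = ε.toReal} with hK
  have hKc : IsCompact K := by
    refine hN₀c.of_isClosed_subset ?_ fun w hw => hw.1
    exact ContinuousOn.preimage_isClosed_of_isClosed (f := fun w => ‖f w‖) (fun w hw =>
      (hP.analytic w (hN₀N hw).2).continuousAt.norm.continuousWithinAt) isClosed_closure
      (isClosed_singleton (x := ε.toReal))
  have hLK : connectedComponentIn (levelSet f G' ε) z ⊆ K := fun w hw =>
    ⟨subset_closure (hLN₀ hw), (hnorm w (hsub hw)).1 (hmod w (subset_closure hw))⟩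
  have hKE : K ⊆ levelSet f G' ε := fun w hw =>
    ⟨hGG' (subset_closure (hN₀N hw.1).2.1), (hnorm w (hN₀N hw.1).2).2 hw.2⟩
  have heq : connectedComponentIn K z = connectedComponentIn (levelSet f G' ε) z :=
    subset_antisymm (connectedComponentIn_mono z hKE)
      (isPreconnected_connectedComponentIn.subset_connectedComponentIn hzL hLK)
  obtain ⟨U, hU, hLU, hUN, hUK⟩ := exists_isOpen_frontier_disjoint hKc (hLK hzL) hN₀
    (heq ▸ hLN₀)
  refine ⟨U, hU, heq ▸ hLU, (closure_mono hUN).trans (hN₀N.trans inter_subset_left), ?_⟩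
  exact fun w hw hwρ => Set.disjoint_left.1 hUK hw ⟨closure_mono hUN hw.1, hwρ⟩

end LevelCurves

theorem mainTheorem8 (G G' : Set ℂ) (f : ℂ → ℂ)
    -- `G` is open and connected, and `f` is meromorphic on the open set `G' ⊇ cl(G)`
    (hG_open : IsOpen G) (hG_conn : IsConnected G)
    (hG'_open : IsOpen G') (hGG' : closure G ⊆ G')
    (hf : MeromorphicNFOn f G')
    -- the complement of `G` has only finitely many bounded components
    (hG_compl : {K ∈ LevelCurves.componentsOf Gᶜ | IsBounded K}.Finite)
    -- `|f| = 1` on each unbounded component of the boundary of `G`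
    (hf_unbdd : ∀ K ∈ LevelCurves.componentsOf (frontier G), ¬ IsBounded K →
      ∀ z ∈ K, LevelCurves.modulus f z = 1)
    -- `|f|` is a constant in `(0, ∞)` on each bounded component of the boundary of `G`
    (hf_bdd : ∀ K ∈ LevelCurves.componentsOf (frontier G), IsBounded K →
      ∃ ρ : ℝ≥0∞, 0 < ρ ∧ ρ < ⊤ ∧ ∀ z ∈ K, LevelCurves.modulus f z = ρ)
    -- if `G` is unbounded, then `|f(z)| → 1` as `z → ∞` in `G`
    (hf_lim : ¬ IsBounded G →
      Tendsto (LevelCurves.modulus f) (cobounded ℂ ⊓ 𝓟 G) (𝓝 1))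
    -- `G` contains no unbounded level curve of `f`
    (h_curve_bdd : ∀ L : Set ℂ, LevelCurves.IsLevelCurve f G' L → L ⊆ G → IsBounded L)
    -- no level curve of `f` in `G` meets the boundary of `G`
    (h_curve_bdry : ∀ z ∈ G, closure (LevelCurves.levelCurveThrough f G' z) ⊆ G) :
    (∀ ε : ℝ≥0∞,
      {L ∈ LevelCurves.componentsOf (LevelCurves.levelSet f G' ε) | L ⊆ G}.Finite) ∧
    {L : Set ℂ | LevelCurves.IsCriticalLevelCurve f G' L ∧ L ⊆ G}.Finite := by
  have hGG := subset_closure.trans hGG'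
  have hnc : ∀ z ∈ G, ∀ c : ℂ, ¬ ∀ᶠ w in 𝓝[≠] z, f w = c := fun z hz c =>
    LevelCurves.not_eventually_const hG_open hG_conn hGG hf h_curve_bdd h_curve_bdry hz c
  have hfin := LevelCurves.finite_zerosAndPoles hGG' hf hf_lim hnc
  obtain ⟨P, hP⟩ := LevelCurves.exists_markedDomain hG_open hGG' hf hG_compl hnc hfin
  have hcurves : ∀ ε : ℝ≥0∞,
      {L ∈ LevelCurves.componentsOf (LevelCurves.levelSet f G' ε) | L ⊆ G}.Finite := by
    intro ε
    by_cases hε : ε = 0 ∨ ε = ⊤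
    -- Such a component is determined by any of its points, each one a zero or pole.
    · refine (hfin.image (connectedComponentIn (LevelCurves.levelSet f G' ε))).subset ?_
      rintro L ⟨⟨z, hz, rfl⟩, hLG⟩
      exact ⟨z, ⟨hLG (mem_connectedComponentIn hz), by rw [hz.2]; exact hε⟩, rfl⟩
    · push Not at hε
      exact LevelCurves.finite_level_curves hP (fun L hL =>
        LevelCurves.markedCurve_of_levelCurve hGG' hf hP h_curve_bdd h_curve_bdry hε.1 hε.2
          hL.1 hL.2) (LevelCurves.pairwiseDisjoint_levelCurves fun L hL => ⟨ε, hL.1⟩)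
  refine ⟨hcurves, ?_⟩
  have hcrit : {L : Set ℂ | LevelCurves.IsLevelCurve f G' L ∧
      (∃ ρ, LevelCurves.MarkedCurve f (G \ LevelCurves.zerosAndPoles f G) ρ L) ∧
      ∃ z ∈ L, deriv f z = 0}.Finite :=
    LevelCurves.finite_critical_curves hP (fun L hL => hL.2)
      (LevelCurves.pairwiseDisjoint_levelCurves fun L hL => hL.1)
  refine (((hcurves 0).union (hcurves ⊤)).union hcrit).subset ?_
  rintro L ⟨⟨⟨ε, hL⟩, -, z, hz, hcz⟩, hLG⟩
  by_cases h0 : ε = 0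
  · exact .inl (.inl ⟨h0 ▸ hL, hLG⟩)
  by_cases htop : ε = ⊤
  · exact .inl (.inr ⟨htop ▸ hL, hLG⟩)
  exact .inr ⟨⟨ε, hL⟩, ⟨_, LevelCurves.markedCurve_of_levelCurve hGG' hf hP h_curve_bdd
    h_curve_bdry h0 htop hL hLG⟩, z, hz, hcz.2⟩
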